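/- Let $d\ge 2$, let $|\psi\rangle\in\mathbb{C}^d$ be a unit vector, and let $n\ge 0$ be an integer. For a unit vector $|\xi\rangle\in\mathbb C^d$ let $R_\xi=\mathbf 1-2|\xi\rangle\langle\xi|$ and let $\mathcal R_\xi(\phi)=R_\xi\phi R_\xi^\dagger$ be the reflection channel. Let $P_n$ be the orthogonal projection onto the symmetric subspace of $(\mathbb{C}^d)^{\otimes n}$, and let $$\mathcal E_{\mathrm{MR},\psi}(\phi)=(\operatorname{tr}P_n)\int d\xi\,|\langle\xi|\psi\rangle|^{2n}\,\mathcal R_\xi(\phi)$$ be the measure-and-reflect channel with $n$ copies of $\psi$, where $d\xi$ is the uniform probability measure on the unit vectors of $\mathbb C^d$. Let $\|X\|_1=\operatorname{tr}\sqrt{X^\dagger X}$, let $\|\Psi\|_\diamond=\max_{\|X\|_1\le 1}\|(\Psi\otimes\mathrm{id}_{\mathbb C^d})(X)\|_1$ be the diamond norm, and put $D_n=\|\mathcal E_{\mathrm{MR},\psi}-\mathcal R_\psi\|_\diamond$. **Theorem.** 1. For all $n$, $$\frac{8(n+1)(d-1)}{(n+d+1)(n+d)}\le D_n .$$ 2.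 If $d=2$, equality holds in 1 for all $n$. 3. For fixed $d$ and $\psi$, as $n\to\infty$, $$D_n\sim\frac{4\left(d-1+\sqrt{d(d-2)+1}\right)}{n}.$$ 4. Consequently the number of copies needed grows with $d$: for every $\varepsilon>0$ the least $n$ with $D_n\le\varepsilon$, denoted $N(\varepsilon)$, exists, and as $\varepsilon\to0^+$ (with $d$ and $\psi$ fixed) $$N(\varepsilon)\sim\frac{4\left(d-1+\sqrt{d(d-2)+1}\right)}{\varepsilon}.$$ -/

import Mathlib

open MeasureTheory Filter Topology Asymptotics
open scoped Matrix

noncomputable section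

namespace MeasureReflect

/-- Operators on `ℂ^d`, as matrices in the standard basis. -/
abbrev Op (ι : Type) : Type := Matrix ι ι ℂ

/-! ### Trace norm and diamond norm -/

/-- The trace norm `‖X‖₁ = tr √(X† X)`: the sum of the square roots of the eigenvalues of `X† X`. -/
def traceNorm {ι : Type} [Fintype ι] [DecidableEq ι] (X : Op ι) : ℝ :=
  ∑ i, √((Matrix.isHermitian_conjTranspose_mul_self X).eigenvalues i)

/-- The induced trace norm `‖Ψ‖₁ = max {‖Ψ(X)‖₁ : ‖X‖₁ ≤ 1}` of a linear map on operators. -/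
def inducedTraceNorm {ι : Type} [Fintype ι] [DecidableEq ι] (Ψ : Op ι →ₗ[ℂ] Op ι) : ℝ :=
  sSup {t : ℝ | ∃ X : Op ι, traceNorm X ≤ 1 ∧ t = traceNorm (Ψ X)}

/-- `Ψ ⊗ id_κ`: the map `Ψ` acts on the first tensor factor, block by block. -/
def tensorId {ι : Type} (κ : Type) (Ψ : Op ι →ₗ[ℂ] Op ι) : Op (ι × κ) →ₗ[ℂ] Op (ι × κ) where
  toFun X := Matrix.of fun p q => Ψ (Matrix.of fun i j => X (i, p.2) (j, q.2)) p.1 q.1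
  map_add' X Y := by
    ext p q
    have h : (Matrix.of fun i j => (X + Y) (i, p.2) (j, q.2)) =
        (Matrix.of fun i j => X (i, p.2) (j, q.2)) +
          (Matrix.of fun i j => Y (i, p.2) (j, q.2)) := by
      ext i j; simp
    simp only [Matrix.of_apply, Matrix.add_apply]
    simp only [Matrix.add_apply] at h
    rw [h, map_add, Matrix.add_apply]
  map_smul' c X := by
    ext p q
    have h : (Matrix.of fun i j => (c • X) (i, p.2) (j, q.2)) =
        c • (Matrix.of fun i j => X (i, p.2) (j, q.2)) := by
      ext i j; simp
    simp only [Matrix.of_apply, Matrix.smul_apply, RingHom.id_apply]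
    simp only [Matrix.smul_apply] at h
    rw [h, map_smul, Matrix.smul_apply]

/-- The diamond norm `‖Ψ ⊗ id‖₁`, with an ancilla of the same dimension as the system. -/
def diamondNorm {ι : Type} [Fintype ι] [DecidableEq ι] (Ψ : Op ι →ₗ[ℂ] Op ι) : ℝ :=
  inducedTraceNorm (tensorId ι Ψ)

/-! ### Reflections -/

/-- The reflection `R_ψ = 1 - 2 |ψ⟩⟨ψ|`. -/
def reflection {d : ℕ} (ψ : EuclideanSpace ℂ (Fin d)) : Op (Fin d) :=
  1 - (2 : ℂ) • Matrix.vecMulVec ψ.ofLp (star ψ.ofLp)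

/-- The reflection channel `X ↦ R_ψ X R_ψ†`. -/
def reflectionChannel {d : ℕ} (ψ : EuclideanSpace ℂ (Fin d)) :
    Op (Fin d) →ₗ[ℂ] Op (Fin d) where
  toFun X := reflection ψ * X * (reflection ψ)ᴴ
  map_add' X Y := by rw [mul_add, add_mul]
  map_smul' c X := by simp

/-! ### The symmetric subspace -/

/-- The symmetric subspace of `(ℂ^d)^{⊗n}`. The latter has the basis `|i₁ … iₙ⟩` indexed by
`Fin n → Fin d`, and permutations of the tensor factors permute the indices. -/
def symmetricSubspace (d n : ℕ) : Submodule ℂ (EuclideanSpace ℂ (Fin n → Fin d)) where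
  carrier := {v | ∀ (σ : Equiv.Perm (Fin n)) (i : Fin n → Fin d), v (i ∘ σ) = v i}
  add_mem' hv hw σ i := by simp [hv σ i, hw σ i]
  zero_mem' σ i := by simp
  smul_mem' c v hv σ i := by simp [hv σ i]

/-- `tr P_n`, where `P_n` is the orthogonal projection onto the symmetric subspace. -/
def symProjTrace (d n : ℕ) : ℂ :=
  LinearMap.trace ℂ (EuclideanSpace ℂ (Fin n → Fin d))
    (symmetricSubspace d n).starProjection.toLinearMap

/-! ### The measure-and-reflect channel -/

/-- The unit sphere of `ℂ^d`. -/
abbrev UnitSphere (d : ℕ) : Type := Metric.sphere (0 : EuclideanSpace ℂ (Fin d)) 1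

/-- The uniform probability measure on the unit vectors of `ℂ^d`: the normalized surface measure. -/
def uniformMeasure (d : ℕ) : Measure (UnitSphere d) :=
  ((volume : Measure (EuclideanSpace ℂ (Fin d))).toSphere Set.univ)⁻¹ •
    (volume : Measure (EuclideanSpace ℂ (Fin d))).toSphere

theorem integrable_entry {d : ℕ} (n : ℕ) (ψ : EuclideanSpace ℂ (Fin d)) (X : Op (Fin d))
    (i j : Fin d) :
    Integrable (fun ξ : UnitSphere d => ((‖inner ℂ ξ.1 ψ‖ ^ (2 * n) : ℝ) : ℂ) *
      reflectionChannel ξ.1 X i j) (uniformMeasure d) := by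
  by_cases hd : (volume : Measure (EuclideanSpace ℂ (Fin d))).toSphere = 0
  · simp [uniformMeasure, hd]
  have hfin : IsFiniteMeasure (uniformMeasure d) := by
    refine ⟨?_⟩
    have h0 : (volume : Measure (EuclideanSpace ℂ (Fin d))).toSphere Set.univ ≠ 0 := by
      rwa [Ne, Measure.measure_univ_eq_zero]
    rw [uniformMeasure, Measure.smul_apply, smul_eq_mul,
      ENNReal.inv_mul_cancel h0 (measure_ne_top _ _)]
    exact ENNReal.one_lt_top
  have hc : Continuous (fun ξ : UnitSphere d => ((‖inner ℂ ξ.1 ψ‖ ^ (2 * n) : ℝ) : ℂ) *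
      reflectionChannel ξ.1 X i j) := by
    simp only [reflectionChannel, LinearMap.coe_mk, AddHom.coe_mk, reflection,
      Matrix.mul_apply, Matrix.sub_apply, Matrix.smul_apply, Matrix.vecMulVec_apply,
      Matrix.conjTranspose_apply, Pi.star_apply]
    fun_prop
  exact hc.integrable_of_hasCompactSupport (HasCompactSupport.of_compactSpace _)

/-- The measure-and-reflect channel
`φ ↦ (tr P_n) ∫ dξ |⟨ξ|ψ⟩|^{2n} R_ξ φ R_ξ†`; the operator-valued integral is taken entrywise. -/
def measureAndReflect {d : ℕ} (n : ℕ) (ψ : EuclideanSpace ℂ (Fin d)) :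
    Op (Fin d) →ₗ[ℂ] Op (Fin d) where
  toFun X := symProjTrace d n • Matrix.of fun i j =>
    ∫ ξ : UnitSphere d, ((‖inner ℂ ξ.1 ψ‖ ^ (2 * n) : ℝ) : ℂ) * reflectionChannel ξ.1 X i j
      ∂(uniformMeasure d)
  map_add' X Y := by
    rw [← smul_add]
    congr 1
    ext i j
    simp only [Matrix.of_apply, Matrix.add_apply]
    rw [← integral_add (integrable_entry n ψ X i j) (integrable_entry n ψ Y i j)]
    simp only [map_add, Matrix.add_apply, mul_add]
  map_smul' c X := by
    rw [RingHom.id_apply, smul_comm c]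
    congr 1
    ext i j
    simp only [Matrix.of_apply, Matrix.smul_apply, smul_eq_mul]
    rw [← integral_const_mul]
    simp only [map_smul, Matrix.smul_apply, smul_eq_mul, mul_left_comm]

/-- The diamond distance between the measure-and-reflect channel with `n` copies of `ψ` and the
reflection channel of `ψ`. -/
def mrDistance {d : ℕ} (n : ℕ) (ψ : EuclideanSpace ℂ (Fin d)) : ℝ :=
  diamondNorm (measureAndReflect n ψ - reflectionChannel ψ)

/-- The least number of copies with which measure-and-reflect reaches diamond distance at most
`ε`. -/
def copyCount {d : ℕ} (ψ : EuclideanSpace ℂ (Fin d)) (ε : ℝ) : ℕ :=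
  sInf {n : ℕ | mrDistance n ψ ≤ ε}

end MeasureReflect

end

/-! Unitary covariance of both channels and invariance of the measure on the sphere reduce
everything to a basis vector `o` in place of ψ (`mrDistance_eq_single`). The kernel of the
difference Ψ then involves only moments of ξ of degree two and four against the weight |ξ_o|^{2n}.
They come from Gaussian integrals, which factor over coordinates and whose radial part splits off in
polar coordinates.

Let P = 1 - |o⟩⟨o|. Up to the factor 4/((n+d)(n+d+1)), Ψ has a signed operator-sum form
(`difference_eq_sum_kraus`). The terms |o⟩⟨a|, |a⟩⟨o|, the traceless operators on the range of P,
and P itself have nonnegative weights. The only negative term is K = x|o⟩⟨o| + yP, with x² =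
(n+1)(d-1) and xy = -(n+d-1)d/2. By Cauchy-Schwarz the diamond norm is at most the operator norm of
∑ |s_k| K_k†K_k (`traceNorm_tensorId_le`). Up to the same factor this sum is 2x²|o⟩⟨o| + 2y²P. Now
y² ≤ x² amounts to (d-2)(n+1-d) ≥ 0, so for d = 2 or n ≥ d-1 the bound is `mrRate d n`.

Conversely, the product input |oo⟩⟨oo| already attains `mrRate d n` for every n
(`le_mrDistance_single`). So D_n equals this rate for d = 2 and for all large n, and n D_n → 8(d-1).
This is the stated constant, since d(d-2)+1 = (d-1)². Inverting a sequence that behaves like c/n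
gives the copy count. -/

noncomputable section

namespace MeasureReflect

/-! ### Trace norm: singular vectors, rank-one decompositions, duality -/

section TraceNorm

variable {ι : Type} [Fintype ι]

/-- The rank-one operator `|a⟩⟨b|`. -/
def rankOne (a b : EuclideanSpace ℂ ι) : Op ι := Matrix.vecMulVec a.ofLp (star b.ofLp)

/-- The action of a matrix on Euclidean vectors. -/
def act (A : Op ι) (x : EuclideanSpace ℂ ι) : EuclideanSpace ℂ ι := WithLp.toLp 2 (A *ᵥ x.ofLp)

theorem rankOne_apply (a b : EuclideanSpace ℂ ι) (i j : ι) :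
    rankOne a b i j = a i * star (b j) := rfl

theorem act_apply (A : Op ι) (x : EuclideanSpace ℂ ι) (i : ι) : act A x i = ∑ j, A i j * x j := rfl

theorem inner_eq_sum (a b : EuclideanSpace ℂ ι) : inner ℂ a b = ∑ i, star (a i) * b i := by
  rw [PiLp.inner_apply]
  exact Finset.sum_congr rfl fun i _ => by rw [RCLike.inner_apply, mul_comm]; rfl

theorem norm_sq_eq_sum (a : EuclideanSpace ℂ ι) : ‖a‖ ^ 2 = ∑ i, ‖a i‖ ^ 2 :=
  EuclideanSpace.norm_sq_eq a

theorem act_rankOne (a b x : EuclideanSpace ℂ ι) : act (rankOne a b) x = inner ℂ b x • a := by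
  ext i
  simp only [act_apply, rankOne_apply, inner_eq_sum, PiLp.smul_apply, smul_eq_mul, Finset.sum_mul]
  exact Finset.sum_congr rfl fun j _ => by ring

theorem act_sum {κ : Type*} (s : Finset κ) (A : κ → Op ι) (x : EuclideanSpace ℂ ι) :
    act (∑ k ∈ s, A k) x = ∑ k ∈ s, act (A k) x := by
  ext i
  simp only [act_apply, Matrix.sum_apply, WithLp.ofLp_sum, Finset.sum_apply, Finset.sum_mul]
  exact Finset.sum_comm

theorem inner_act_left (A : Op ι) (x y : EuclideanSpace ℂ ι) :
    inner ℂ (act A x) y = inner ℂ x (act Aᴴ y) := by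
  simp only [inner_eq_sum, act_apply, star_sum, Finset.sum_mul, Finset.mul_sum, star_mul,
    Matrix.conjTranspose_apply]
  rw [Finset.sum_comm]
  exact Finset.sum_congr rfl fun i _ => Finset.sum_congr rfl fun j _ => by ring

theorem act_mul (A B : Op ι) (x : EuclideanSpace ℂ ι) : act (A * B) x = act A (act B x) := by
  simp [act, Matrix.mulVec_mulVec]

theorem mul_rankOne_mul (A B : Op ι) (a b : EuclideanSpace ℂ ι) :
    A * rankOne a b * B = rankOne (act A a) (act Bᴴ b) := by
  ext i j
  simp only [Matrix.mul_apply, rankOne_apply, act_apply, star_sum, star_mul,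
    Matrix.conjTranspose_apply, star_star, Finset.sum_mul, Finset.mul_sum]
  exact Finset.sum_congr rfl fun i _ => Finset.sum_congr rfl fun j _ => by ring

theorem trace_rankOne (a b : EuclideanSpace ℂ ι) : (rankOne a b).trace = inner ℂ b a := by
  simp only [Matrix.trace, Matrix.diag_apply, rankOne_apply, inner_eq_sum]
  exact Finset.sum_congr rfl fun i _ => by ring

/-- For the basis `singularBasis X` this is the singular value decomposition, and its cost ∑ ‖a‖‖b‖
is exactly the trace norm. -/
theorem eq_sum_rankOne (X : Op ι) (v : OrthonormalBasis ι ℂ (EuclideanSpace ℂ ι)) :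
    X = ∑ i, rankOne (act X (v i)) (v i) := by
  have h : ∀ x, act X x = act (∑ i, rankOne (act X (v i)) (v i)) x := fun x => by
    rw [act_sum]
    simp only [act_rankOne]
    conv_lhs => rw [← v.sum_repr' x]
    ext i
    simp only [act_apply, WithLp.ofLp_sum, Finset.sum_apply, PiLp.smul_apply, smul_eq_mul,
      Finset.mul_sum]
    rw [Finset.sum_comm]
    exact Finset.sum_congr rfl fun i _ => Finset.sum_congr rfl fun j _ => by ring
  classical
  refine Matrix.toEuclideanLin.injective (LinearMap.ext fun x => ?_)
  exact h x

variable [DecidableEq ι]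

/-- An orthonormal basis of right singular vectors. -/
def singularBasis (X : Op ι) : OrthonormalBasis ι ℂ (EuclideanSpace ℂ ι) :=
  (Matrix.isHermitian_conjTranspose_mul_self X).eigenvectorBasis

theorem norm_act_singularBasis (X : Op ι) (i : ι) :
    ‖act X (singularBasis X i)‖ =
      √((Matrix.isHermitian_conjTranspose_mul_self X).eigenvalues i) := by
  set hX := Matrix.isHermitian_conjTranspose_mul_self X
  have h : act (Xᴴ * X) (singularBasis X i) = (hX.eigenvalues i : ℂ) • singularBasis X i := by
    ext j
    have := congrFun (hX.mulVec_eigenvectorBasis i) j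
    simpa [act, singularBasis] using this
  have h2 : inner ℂ (act X (singularBasis X i)) (act X (singularBasis X i)) =
      (hX.eigenvalues i : ℂ) := by
    rw [inner_act_left, ← act_mul, h, inner_smul_right, inner_self_eq_norm_sq_to_K]
    simp
  rw [inner_self_eq_norm_sq_to_K] at h2
  have h3 : ‖act X (singularBasis X i)‖ ^ 2 = hX.eigenvalues i := Complex.ofReal_injective (by
    rw [← h2]
    simp)
  rw [← h3, Real.sqrt_sq (norm_nonneg _)]

theorem traceNorm_eq_sum_norm (X : Op ι) : traceNorm X = ∑ i, ‖act X (singularBasis X i)‖ :=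
  Finset.sum_congr rfl fun i _ => (norm_act_singularBasis X i).symm

theorem inner_act_singularBasis_of_ne (X : Op ι) {i j : ι} (hij : i ≠ j) :
    inner ℂ (act X (singularBasis X i)) (act X (singularBasis X j)) = 0 := by
  set hX := Matrix.isHermitian_conjTranspose_mul_self X
  have h : act (Xᴴ * X) (singularBasis X j) = (hX.eigenvalues j : ℂ) • singularBasis X j := by
    ext k
    have := congrFun (hX.mulVec_eigenvectorBasis j) k
    simpa [act, singularBasis] using this
  rw [inner_act_left, ← act_mul, h, inner_smul_right, (singularBasis X).orthonormal.2 hij, mul_zero]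

/-- The trace norm is dominated by the cost of any decomposition into rank-one operators. -/
theorem traceNorm_sum_rankOne_le {κ : Type*} (s : Finset κ) (a b : κ → EuclideanSpace ℂ ι) :
    traceNorm (∑ k ∈ s, rankOne (a k) (b k)) ≤ ∑ k ∈ s, ‖a k‖ * ‖b k‖ := by
  set Y := ∑ k ∈ s, rankOne (a k) (b k) with hY
  set v := singularBasis Y
  -- Zero singular values are dropped so that the left singular vectors `w` can be normalized.
  let t : Finset ι := Finset.univ.filter fun i => act Y (v i) ≠ 0
  let w : t → EuclideanSpace ℂ ι := fun i =>
    ((‖act Y (v i)‖⁻¹ : ℝ) : ℂ) • act Y (v i)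
  have hne : ∀ i : t, act Y (v i) ≠ 0 := fun i => (Finset.mem_filter.1 i.2).2
  have hw : Orthonormal ℂ w := by
    constructor
    · intro i
      have := norm_ne_zero_iff.2 (hne i)
      simp [w, norm_smul, this]
    · intro i j hij
      simp only [w, inner_smul_left, inner_smul_right]
      rw [inner_act_singularBasis_of_ne Y (fun h => hij (Subtype.ext h))]
      simp
  have h1 : traceNorm Y = ∑ i : t, ‖act Y (v i)‖ := by
    rw [traceNorm_eq_sum_norm, Finset.sum_coe_sort t (fun i => ‖act Y (v i)‖)]
    symm
    refine Finset.sum_subset (Finset.subset_univ _) fun i _ hi => ?_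
    simpa [t] using hi
  have h2 : ∀ i : t, (‖act Y (v i)‖ : ℂ) = ∑ k ∈ s, inner ℂ (w i) (a k) * inner ℂ (b k) (v i) := by
    intro i
    have e1 : inner ℂ (w i) (act Y (v i)) = (‖act Y (v i)‖ : ℂ) := by
      have := norm_ne_zero_iff.2 (hne i)
      have h' : (‖act Y (v i)‖ : ℂ) ≠ 0 := by exact_mod_cast this
      simp only [w, inner_smul_left, inner_self_eq_norm_sq_to_K, Complex.conj_ofReal]
      push_cast
      field_simp
      simp
    rw [← e1]
    conv_lhs => rw [hY, act_sum]
    simp only [act_rankOne, inner_sum, inner_smul_right]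
    exact Finset.sum_congr rfl fun i _ => by ring
  have h3 : traceNorm Y ≤ ∑ k ∈ s, ∑ i : t, ‖inner ℂ (w i) (a k)‖ * ‖inner ℂ (b k) (v i)‖ := by
    rw [h1, Finset.sum_comm]
    refine Finset.sum_le_sum fun i _ => ?_
    have : ‖act Y (v i)‖ = ‖(‖act Y (v i)‖ : ℂ)‖ := by simp
    rw [this, h2 i]
    refine (norm_sum_le _ _).trans (le_of_eq ?_)
    simp
  refine h3.trans (Finset.sum_le_sum fun k _ => ?_)
  -- Cauchy-Schwarz in `i`, then Bessel's inequality for each of the orthonormal families `w` and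
  -- `v`.
  refine (Real.sum_mul_le_sqrt_mul_sqrt _ _ _).trans ?_
  refine mul_le_mul ?_ ?_ (Real.sqrt_nonneg _) (norm_nonneg _)
  · exact Real.sqrt_le_iff.2 ⟨norm_nonneg _, hw.sum_inner_products_le (a k) (s := Finset.univ)⟩
  · refine Real.sqrt_le_iff.2 ⟨norm_nonneg _, ?_⟩
    have := (v.orthonormal.comp _ (Subtype.val_injective (p := (· ∈ t)))).sum_inner_products_le
      (b k) (s := Finset.univ)
    refine le_trans (le_of_eq ?_) this
    exact Finset.sum_congr rfl fun i _ => by rw [norm_inner_symm]; rfl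

/-- One half of trace-norm duality: any contraction `U` serves as a witness for a lower bound. It
follows term by term from the singular value decomposition. -/
theorem norm_trace_mul_le_traceNorm (U Y : Op ι) (hU : ∀ x, ‖act U x‖ ≤ ‖x‖) :
    ‖(U * Y).trace‖ ≤ traceNorm Y := by
  rw [traceNorm_eq_sum_norm]
  conv_lhs => rw [eq_sum_rankOne Y (singularBasis Y)]
  rw [Finset.mul_sum, Matrix.trace_sum]
  refine (norm_sum_le _ _).trans (Finset.sum_le_sum fun i _ => ?_)
  have := mul_rankOne_mul U 1 (act Y (singularBasis Y i)) (singularBasis Y i)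
  rw [mul_one] at this
  rw [this, trace_rankOne]
  refine (norm_inner_le_norm _ _).trans ?_
  have h1 : act (1 : Op ι)ᴴ (singularBasis Y i) = singularBasis Y i := by simp [act]
  rw [h1, (singularBasis Y).orthonormal.1 i, one_mul]
  exact hU _

theorem norm_act_of_unitary {U : Op ι} (hU : Uᴴ * U = 1) (x : EuclideanSpace ℂ ι) :
    ‖act U x‖ = ‖x‖ := by
  have h : inner ℂ (act U x) (act U x) = inner ℂ x x := by
    rw [inner_act_left, ← act_mul, hU]
    simp [act]
  rw [inner_self_eq_norm_sq_to_K, inner_self_eq_norm_sq_to_K] at h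
  have h2 : ‖act U x‖ ^ 2 = ‖x‖ ^ 2 := by exact_mod_cast h
  exact (sq_eq_sq₀ (norm_nonneg _) (norm_nonneg _)).1 h2

theorem traceNorm_mul_mul_le {U V : Op ι} (hU : Uᴴ * U = 1) (hV : V * Vᴴ = 1) (X : Op ι) :
    traceNorm (U * X * V) ≤ traceNorm X := by
  rw [traceNorm_eq_sum_norm X]
  conv_lhs => rw [eq_sum_rankOne X (singularBasis X), Finset.mul_sum, Finset.sum_mul]
  simp only [mul_rankOne_mul]
  refine (traceNorm_sum_rankOne_le _ _ _).trans (Finset.sum_le_sum fun i _ => ?_)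
  rw [norm_act_of_unitary hU, norm_act_of_unitary (U := Vᴴ) (by simpa using hV),
    (singularBasis X).orthonormal.1 i, mul_one]

theorem traceNorm_conj {U : Op ι} (hU : Uᴴ * U = 1) (X : Op ι) :
    traceNorm (U * X * Uᴴ) = traceNorm X := by
  have hU' : U * Uᴴ = 1 := mul_eq_one_comm.1 hU
  refine le_antisymm (traceNorm_mul_mul_le hU (by simpa using hU) X) ?_
  have := traceNorm_mul_mul_le (U := Uᴴ) (V := U) (by simpa using hU') hU' (U * X * Uᴴ)
  rwa [show Uᴴ * (U * X * Uᴴ) * U = (Uᴴ * U) * X * (Uᴴ * U) by simp only [mul_assoc], hU,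
    one_mul, mul_one] at this

end TraceNorm

/-! ### Diamond norm: operator-sum bounds and unitary covariance -/

section Kraus

variable {ι κ : Type} [Fintype ι] [Fintype κ]

/-- `A ⊗ 1` applied to a vector of the composite system. -/
def actLeft (A : Op ι) (x : EuclideanSpace ℂ (ι × κ)) : EuclideanSpace ℂ (ι × κ) :=
  WithLp.toLp 2 fun p => ∑ j, A p.1 j * x (j, p.2)

theorem actLeft_apply (A : Op ι) (x : EuclideanSpace ℂ (ι × κ)) (p : ι × κ) :
    actLeft A x p = ∑ j, A p.1 j * x (j, p.2) := rfl

theorem tensorId_conj_rankOne (A : Op ι) (x y : EuclideanSpace ℂ (ι × κ)) (p q : ι × κ) :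
    (A * (Matrix.of fun i j => rankOne x y (i, p.2) (j, q.2)) * Aᴴ) p.1 q.1 =
      rankOne (actLeft A x) (actLeft A y) p q := by
  simp only [Matrix.mul_apply, Matrix.of_apply, rankOne_apply, actLeft_apply, star_sum, star_mul,
    Matrix.conjTranspose_apply, Finset.sum_mul, Finset.mul_sum]
  exact Finset.sum_congr rfl fun i _ => Finset.sum_congr rfl fun j _ => by ring

theorem norm_sq_actLeft (A : Op ι) (x : EuclideanSpace ℂ (ι × κ)) :
    ‖actLeft A x‖ ^ 2 = ∑ b, ‖act A (WithLp.toLp 2 fun j => x (j, b))‖ ^ 2 := by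
  rw [norm_sq_eq_sum, Fintype.sum_prod_type, Finset.sum_comm]
  exact Finset.sum_congr rfl fun b _ => by rw [norm_sq_eq_sum]; rfl

variable [DecidableEq ι] [DecidableEq κ] {μ : Type*} [Fintype μ]

/-- A signed operator-sum representation bounds the trace norm of the extended map. -/
theorem traceNorm_tensorId_le (Ψ : Op ι →ₗ[ℂ] Op ι) (s : μ → ℝ) (K : μ → Op ι)
    (hΨ : ∀ X, Ψ X = ∑ k, (s k : ℂ) • (K k * X * (K k)ᴴ)) {C : ℝ} (hC0 : 0 ≤ C)
    (hC : ∀ x, ∑ k, |s k| * ‖act (K k) x‖ ^ 2 ≤ C * ‖x‖ ^ 2) (X : Op (ι × κ)) :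
    traceNorm (tensorId κ Ψ X) ≤ C * traceNorm X := by
  set v := singularBasis X
  -- Slicing a composite vector along the ancilla index reduces the bound to the system alone.
  have hsum : ∀ x : EuclideanSpace ℂ (ι × κ),
      ∑ k, |s k| * ‖actLeft (K k) x‖ ^ 2 ≤ C * ‖x‖ ^ 2 := fun x => by
    have e1 : ∑ k, |s k| * ‖actLeft (K k) x‖ ^ 2 =
        ∑ b, ∑ k, |s k| * ‖act (K k) (WithLp.toLp 2 fun j => x (j, b))‖ ^ 2 := by
      simp only [norm_sq_actLeft, Finset.mul_sum]
      exact Finset.sum_comm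
    have e2 : ‖x‖ ^ 2 = ∑ b, ‖(WithLp.toLp 2 fun j => x (j, b) : EuclideanSpace ℂ ι)‖ ^ 2 := by
      simp only [norm_sq_eq_sum]
      rw [Fintype.sum_prod_type, Finset.sum_comm]
    rw [e1, e2, Finset.mul_sum]
    exact Finset.sum_le_sum fun b _ => hC _
  have h1 : tensorId κ Ψ X = ∑ z : (ι × κ) × μ,
      rankOne ((s z.2 : ℂ) • actLeft (K z.2) (act X (v z.1))) (actLeft (K z.2) (v z.1)) := by
    conv_lhs => rw [eq_sum_rankOne X v, map_sum]
    rw [Fintype.sum_prod_type (γ := _) (f := fun z : (ι × κ) × μ =>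
      rankOne ((s z.2 : ℂ) • actLeft (K z.2) (act X (v z.1))) (actLeft (K z.2) (v z.1)))]
    refine Finset.sum_congr rfl fun i _ => ?_
    ext p q
    simp only [tensorId, LinearMap.coe_mk, AddHom.coe_mk, Matrix.of_apply, hΨ, Matrix.sum_apply,
      Matrix.smul_apply, tensorId_conj_rankOne]
    refine Finset.sum_congr rfl fun k _ => ?_
    simp only [rankOne_apply, PiLp.smul_apply, smul_eq_mul]
    ring
  rw [h1]
  refine (traceNorm_sum_rankOne_le _ _ _).trans ?_
  rw [Fintype.sum_prod_type, traceNorm_eq_sum_norm, Finset.mul_sum]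
  refine Finset.sum_le_sum fun i _ => ?_
  -- The weight |s| is shared as √|s|·√|s| between left and right singular vectors, so that
  -- Cauchy-Schwarz in `k` leads back to `hsum` twice.
  have h2 : ∀ k, ‖(s k : ℂ) • actLeft (K k) (act X (v i))‖ * ‖actLeft (K k) (v i)‖ =
      (√|s k| * ‖actLeft (K k) (act X (v i))‖) * (√|s k| * ‖actLeft (K k) (v i)‖) := fun k => by
    rw [norm_smul, Complex.norm_real, Real.norm_eq_abs]
    nth_rewrite 1 [← Real.mul_self_sqrt (abs_nonneg (s k))]
    ring
  simp only [h2]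
  refine (Real.sum_mul_le_sqrt_mul_sqrt _ _ _).trans ?_
  simp only [mul_pow, Real.sq_sqrt (abs_nonneg _)]
  have h3 := Real.sqrt_le_sqrt (hsum (act X (v i)))
  have h4 := Real.sqrt_le_sqrt (hsum (v i))
  refine (mul_le_mul h3 h4 (Real.sqrt_nonneg _) (Real.sqrt_nonneg _)).trans (le_of_eq ?_)
  rw [v.orthonormal.1 i, Real.sqrt_mul hC0, Real.sqrt_mul hC0, Real.sqrt_sq (norm_nonneg _)]
  have := Real.mul_self_sqrt hC0
  simp only [one_pow, Real.sqrt_one, mul_one]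
  linear_combination ‖act X (v i)‖ * this

theorem diamondNorm_le (Ψ : Op ι →ₗ[ℂ] Op ι) {C : ℝ} (hC0 : 0 ≤ C)
    (h : ∀ X : Op (ι × ι), traceNorm (tensorId ι Ψ X) ≤ C * traceNorm X) : diamondNorm Ψ ≤ C := by
  refine Real.sSup_le ?_ hC0
  rintro t ⟨X, hX, rfl⟩
  exact (h X).trans (mul_le_of_le_one_right hC0 hX)

/-- The bound `C` provides boundedness above, without which the real `sSup` would take its default
value 0. -/
theorem le_diamondNorm (Ψ : Op ι →ₗ[ℂ] Op ι) {C : ℝ} (hC0 : 0 ≤ C)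
    (h : ∀ X : Op (ι × ι), traceNorm (tensorId ι Ψ X) ≤ C * traceNorm X) (X : Op (ι × ι))
    (hX : traceNorm X ≤ 1) : traceNorm (tensorId ι Ψ X) ≤ diamondNorm Ψ := by
  refine le_csSup ⟨C, ?_⟩ ⟨X, hX, rfl⟩
  rintro t ⟨X, hX, rfl⟩
  exact (h X).trans (mul_le_of_le_one_right hC0 hX)

open scoped Kronecker in
theorem block_kronecker_mul_mul (A B : Op ι) (X : Op (ι × κ)) (b c : κ) :
    (Matrix.of fun i j => ((A ⊗ₖ (1 : Op κ) : Op (ι × κ)) * X * (B ⊗ₖ (1 : Op κ) : Op (ι × κ)) :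
      Op (ι × κ)) (i, b) (j, c)) = A * (Matrix.of fun i j => X (i, b) (j, c)) * B := by
  ext i j
  simp [Matrix.mul_apply, Fintype.sum_prod_type, Matrix.kroneckerMap_apply, Matrix.one_apply]

open scoped Kronecker in
theorem tensorId_conj (Ψ Φ : Op ι →ₗ[ℂ] Op ι) {U : Op ι}
    (h : ∀ X, Φ X = U * Ψ (Uᴴ * X * U) * Uᴴ) (X : Op (ι × κ)) :
    tensorId κ Φ X = (U ⊗ₖ (1 : Op κ) : Op (ι × κ)) *
      tensorId κ Ψ ((U ⊗ₖ (1 : Op κ) : Op (ι × κ))ᴴ * X * (U ⊗ₖ (1 : Op κ) : Op (ι × κ))) *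
      (U ⊗ₖ (1 : Op κ) : Op (ι × κ))ᴴ := by
  rw [Matrix.conjTranspose_kronecker, Matrix.conjTranspose_one]
  ext ⟨i, b⟩ ⟨j, c⟩
  have e := congrFun (congrFun (block_kronecker_mul_mul U Uᴴ (tensorId κ Ψ
    ((Uᴴ ⊗ₖ (1 : Op κ) : Op (ι × κ)) * X * (U ⊗ₖ (1 : Op κ) : Op (ι × κ)))) b c) i) j
  rw [Matrix.of_apply] at e
  rw [e]
  simp only [tensorId, LinearMap.coe_mk, AddHom.coe_mk, Matrix.of_apply, h,
    block_kronecker_mul_mul]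
  rfl

open scoped Kronecker in
-- Conjugation by U ⊗ 1 preserves the trace norm, so it permutes the admissible inputs without
-- changing the output norms.
theorem diamondNorm_conj (Ψ Φ : Op ι →ₗ[ℂ] Op ι) {U : Op ι} (hU : Uᴴ * U = 1)
    (h : ∀ X, Φ X = U * Ψ (Uᴴ * X * U) * Uᴴ) : diamondNorm Φ = diamondNorm Ψ := by
  set W : Op (ι × ι) := U ⊗ₖ 1
  have hW : Wᴴ * W = 1 := by
    rw [Matrix.conjTranspose_kronecker, ← Matrix.mul_kronecker_mul, hU]
    simp
  have hW' : W * Wᴴ = 1 := mul_eq_one_comm.1 hW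
  have key : ∀ X, traceNorm (tensorId ι Φ X) = traceNorm (tensorId ι Ψ (Wᴴ * X * W)) := fun X => by
    rw [tensorId_conj Ψ Φ h, traceNorm_conj hW]
  have hc : ∀ X, traceNorm (Wᴴ * X * W) = traceNorm X := fun X => by
    have := traceNorm_conj (U := Wᴴ) (by simpa using hW') X
    simpa using this
  unfold diamondNorm inducedTraceNorm
  congr 1
  ext t
  constructor
  · rintro ⟨X, hX, rfl⟩
    exact ⟨Wᴴ * X * W, (hc X).trans_le hX, key X⟩
  · rintro ⟨X, hX, rfl⟩
    refine ⟨W * X * Wᴴ, (traceNorm_conj hW X).trans_le hX, ?_⟩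
    rw [key, show Wᴴ * (W * X * Wᴴ) * W = (Wᴴ * W) * X * (Wᴴ * W) by simp only [mul_assoc], hW,
      one_mul, mul_one]

end Kraus

/-! ### Dimension of the symmetric subspace -/

section SymmetricSubspace

variable {d n : ℕ}

/-- The multiset of values of a tuple. -/
def tupleSym (i : Fin n → Fin d) : Sym (Fin d) n := ⟨Finset.univ.val.map i, by simp⟩

theorem tupleSym_surjective : Function.Surjective (tupleSym (d := d) (n := n)) := by
  rintro ⟨m, hm⟩
  obtain ⟨l, rfl⟩ := Quot.exists_rep m
  have hl : l.length = n := hm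
  subst hl
  refine ⟨l.get, Subtype.ext ?_⟩
  simp only [tupleSym, Fin.univ_val_map]
  rw [List.ofFn_get]
  rfl

/-- Equal multiplicities make the fibres over each value equinumerous; bijections between fibres
glue to a permutation. -/
theorem exists_perm_of_tupleSym_eq {i j : Fin n → Fin d} (h : tupleSym i = tupleSym j) :
    ∃ σ : Equiv.Perm (Fin n), j ∘ σ = i := by
  have hc : ∀ c, Fintype.card {a // i a = c} = Fintype.card {a // j a = c} := fun c => by
    have := congrArg (fun s : Sym (Fin d) n => Multiset.count c (s : Multiset (Fin d))) h
    simp only [tupleSym, Sym.coe_mk, Multiset.count_map] at this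
    rw [Fintype.card_subtype, Fintype.card_subtype]
    simpa [Finset.card_def, Finset.filter_val, eq_comm] using this
  exact ⟨Equiv.ofFiberEquiv fun c => Fintype.equivOfCardEq (hc c),
    funext fun a => Equiv.ofFiberEquiv_map _ a⟩

theorem tupleSym_comp_perm (i : Fin n → Fin d) (σ : Equiv.Perm (Fin n)) :
    tupleSym (i ∘ σ) = tupleSym i := by
  refine Subtype.ext ?_
  simp only [tupleSym]
  rw [← Multiset.map_map, Multiset.map_univ_val_equiv]

/-- The symmetric tensor with prescribed coefficients. -/
def ofSymCoeff (d n : ℕ) : (Sym (Fin d) n → ℂ) →ₗ[ℂ] EuclideanSpace ℂ (Fin n → Fin d) where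
  toFun f := WithLp.toLp 2 fun i => f (tupleSym i)
  map_add' _ _ := rfl
  map_smul' _ _ := rfl

theorem ofSymCoeff_apply (f : Sym (Fin d) n → ℂ) (i : Fin n → Fin d) :
    ofSymCoeff d n f i = f (tupleSym i) := rfl

theorem range_ofSymCoeff : LinearMap.range (ofSymCoeff d n) = symmetricSubspace d n := by
  ext v
  constructor
  · rintro ⟨f, rfl⟩ σ i
    rw [ofSymCoeff_apply, ofSymCoeff_apply, tupleSym_comp_perm]
  · intro hv
    refine ⟨fun s => v (Function.surjInv tupleSym_surjective s), ?_⟩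
    ext i
    rw [ofSymCoeff_apply]
    obtain ⟨σ, hσ⟩ := exists_perm_of_tupleSym_eq
      (Function.surjInv_eq tupleSym_surjective (tupleSym i))
    rw [← hσ]
    exact hv σ i

theorem finrank_symmetricSubspace :
    Module.finrank ℂ (symmetricSubspace d n) = (d + n - 1).choose n := by
  rw [← range_ofSymCoeff, LinearMap.finrank_range_of_inj, Module.finrank_fintype_fun_eq_card,
    Sym.card_sym_eq_choose, Fintype.card_fin]
  intro f g h
  funext s
  obtain ⟨i, rfl⟩ := tupleSym_surjective s
  exact congrFun (congrArg WithLp.ofLp h) i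

theorem symProjTrace_eq_choose : symProjTrace d n = ((d + n - 1).choose n : ℂ) := by
  rw [symProjTrace, LinearMap.IsProj.trace (p := symmetricSubspace d n),
    finrank_symmetricSubspace]
  exact ⟨fun x => (Submodule.starProjection_apply_mem _ x),
    fun x hx => Submodule.starProjection_eq_self_iff.2 hx⟩

end SymmetricSubspace

/-! ### Gaussian moments on ℂ and ℂ^d -/

section Gaussian

theorem integral_pow_mul_conj_pow_self (a : ℕ) :
    ∫ z : ℂ, z ^ a * star z ^ a * (Real.exp (-‖z‖ ^ 2) : ℂ) = (Real.pi * a.factorial : ℂ) := by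
  have h := Complex.integral_rpow_mul_exp_neg_rpow (p := 2) (q := 2 * a) (by norm_num)
    (by have : (0 : ℝ) ≤ a := a.cast_nonneg
        linarith)
  have e : ∀ z : ℂ, z ^ a * star z ^ a * (Real.exp (-‖z‖ ^ 2) : ℂ) =
      ((‖z‖ ^ (2 * a : ℝ) * Real.exp (-‖z‖ ^ (2 : ℝ)) : ℝ) : ℂ) := fun z => by
    rw [← mul_pow]
    have h1 : z * star z = ((‖z‖ ^ 2 : ℝ) : ℂ) := by
      rw [Complex.star_def, Complex.mul_conj, Complex.normSq_eq_norm_sq]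
    rw [h1, Real.rpow_two, show (2 * a : ℝ) = ((2 * a : ℕ) : ℝ) by push_cast; ring,
      Real.rpow_natCast, pow_mul]
    push_cast
    ring
  simp only [e]
  rw [integral_complex_ofReal, h, show ((2 * a + 2) / 2 : ℝ) = a + 1 by ring,
    Real.Gamma_nat_eq_factorial]
  push_cast
  ring

theorem integral_pow_mul_conj_pow_of_ne {a b : ℕ} (hab : a ≠ b) :
    ∫ z : ℂ, z ^ a * star z ^ b * (Real.exp (-‖z‖ ^ 2) : ℂ) = 0 := by
  set I := ∫ z : ℂ, z ^ a * star z ^ b * (Real.exp (-‖z‖ ^ 2) : ℂ) with hI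
  let u : Circle := Circle.exp (Real.pi / ((a : ℝ) - b))
  have hne : ((a : ℂ) - b) ≠ 0 := sub_ne_zero.2 (by exact_mod_cast hab)
  -- The angle π/(a-b) makes the rotation multiply the integrand by e^{iπ} = -1, which forces the
  -- integral to vanish.
  have hu : (u : ℂ) ^ a * star (u : ℂ) ^ b = -1 := by
    simp only [u, Circle.coe_exp, Complex.star_def, ← Complex.exp_conj, ← Complex.exp_nat_mul]
    rw [← Complex.exp_add, ← Complex.exp_pi_mul_I]
    congr 1
    simp only [map_mul, Complex.conj_ofReal, Complex.conj_I]
    push_cast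
    field_simp
    ring
  have h := (rotation u).measurePreserving.integral_comp
    (rotation u).toHomeomorph.measurableEmbedding
    (fun z : ℂ => z ^ a * star z ^ b * (Real.exp (-‖z‖ ^ 2) : ℂ))
  have e : ∀ z : ℂ, (rotation u z) ^ a * star (rotation u z) ^ b *
      (Real.exp (-‖rotation u z‖ ^ 2) : ℂ) =
      (-1) * (z ^ a * star z ^ b * (Real.exp (-‖z‖ ^ 2) : ℂ)) := fun z => by
    rw [LinearIsometryEquiv.norm_map, rotation_apply, star_mul, mul_pow, mul_pow, ← hu]
    ring
  simp only [e] at h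
  rw [integral_const_mul, ← hI] at h
  have h2 : I + I = 0 := by linear_combination -h
  exact self_eq_neg.1 (by linear_combination h2)

theorem integral_pow_mul_conj_pow (a b : ℕ) :
    ∫ z : ℂ, z ^ a * star z ^ b * (Real.exp (-‖z‖ ^ 2) : ℂ) =
      if a = b then (Real.pi * a.factorial : ℂ) else 0 := by
  split_ifs with h
  · rw [← h, integral_pow_mul_conj_pow_self]
  · exact integral_pow_mul_conj_pow_of_ne h

variable {d : ℕ}

/-- Uniqueness of Haar measure. The value of the constant is irrelevant, since it cancels when the
sphere measure is normalized. -/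
theorem exists_volume_eq_smul (d : ℕ) : ∃ c : NNReal, c ≠ 0 ∧
    (volume : Measure (EuclideanSpace ℂ (Fin d))) =
      c • (volume : Measure (Fin d → ℂ)).map (MeasurableEquiv.toLp 2 (Fin d → ℂ)) := by
  let L : (Fin d → ℂ) ≃L[ℝ] EuclideanSpace ℂ (Fin d) :=
    (PiLp.continuousLinearEquiv 2 ℝ fun _ : Fin d => ℂ).symm
  have hL := ContinuousLinearEquiv.isAddHaarMeasure_map L (volume : Measure (Fin d → ℂ))
  exact ⟨_, (Measure.addHaarScalarFactor_pos_of_isAddHaarMeasure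
    (volume : Measure (EuclideanSpace ℂ (Fin d))) (volume.map L)).ne',
    Measure.isAddLeftInvariant_eq_smul _ _⟩

theorem exists_integral_monomial (d : ℕ) : ∃ c : ℂ, c ≠ 0 ∧ ∀ α β : Fin d → ℕ,
    ∫ x : EuclideanSpace ℂ (Fin d), (∏ i, x i ^ α i * star (x i) ^ β i) *
      (Real.exp (-‖x‖ ^ 2) : ℂ) = if α = β then c * ∏ i, ((α i).factorial : ℂ) else 0 := by
  obtain ⟨c, hc, hvol⟩ := exists_volume_eq_smul d
  refine ⟨c * Real.pi ^ d, by simp [hc, Real.pi_ne_zero], fun α β => ?_⟩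
  rw [hvol, integral_smul_nnreal_measure, integral_map_equiv]
  have e : ∀ x : Fin d → ℂ, (∏ i, (MeasurableEquiv.toLp 2 (Fin d → ℂ) x) i ^ α i *
      star ((MeasurableEquiv.toLp 2 (Fin d → ℂ) x) i) ^ β i) *
      (Real.exp (-‖MeasurableEquiv.toLp 2 (Fin d → ℂ) x‖ ^ 2) : ℂ) =
      ∏ i, (x i ^ α i * star (x i) ^ β i * (Real.exp (-‖x i‖ ^ 2) : ℂ)) := fun x => by
    rw [norm_sq_eq_sum, ← Finset.sum_neg_distrib, Real.exp_sum, Complex.ofReal_prod,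
      ← Finset.prod_mul_distrib]
    rfl
  simp only [e]
  rw [volume_pi, integral_fintype_prod_eq_prod (𝕜 := ℂ)
    (f := fun i z => z ^ α i * star z ^ β i * (Real.exp (-‖z‖ ^ 2) : ℂ))]
  simp only [integral_pow_mul_conj_pow]
  split_ifs with h
  · subst h
    simp [Finset.prod_mul_distrib, NNReal.smul_def]
    ring
  · obtain ⟨i, hi⟩ := Function.ne_iff.1 h
    rw [Finset.prod_eq_zero (Finset.mem_univ i) (if_neg hi), smul_zero]

end Gaussian

/-! ### Moments and invariance of the uniform measure on the sphere -/

section Sphere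

variable {d : ℕ}

theorem finrank_real_euclideanSpace (d : ℕ) :
    Module.finrank ℝ (EuclideanSpace ℂ (Fin d)) = 2 * d := by
  rw [finrank_real_of_complex, finrank_euclideanSpace, Fintype.card_fin]

theorem integral_pow_mul_exp_neg_sq (k : ℕ) :
    ∫ r in Set.Ioi (0 : ℝ), r ^ (2 * k + 1) * Real.exp (-r ^ 2) = k.factorial / 2 := by
  have h := integral_rpow_mul_exp_neg_rpow (p := 2) (q := ((2 * k + 1 : ℕ) : ℝ)) (by norm_num)
    (by have : (0 : ℝ) ≤ ((2 * k + 1 : ℕ) : ℝ) := Nat.cast_nonneg _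
        linarith)
  simp only [Real.rpow_natCast, Real.rpow_two] at h
  rw [h, show (((2 * k + 1 : ℕ) : ℝ) + 1) / 2 = k + 1 by push_cast; ring,
    Real.Gamma_nat_eq_factorial]
  ring

/-- Polar coordinates for the Gaussian integral of a homogeneous function. -/
theorem integral_homogeneous_mul_exp (hd : 0 < d) (t : ℕ) (G : EuclideanSpace ℂ (Fin d) → ℂ)
    (hG : ∀ r : ℝ, 0 < r → ∀ x, G (r • x) = (r : ℂ) ^ (2 * t) * G x) :
    ∫ x, G x * (Real.exp (-‖x‖ ^ 2) : ℂ) =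
      (∫ ξ : UnitSphere d, G ξ.1 ∂(volume : Measure (EuclideanSpace ℂ (Fin d))).toSphere) *
        ((d + t - 1).factorial / 2 : ℂ) := by
  have : Nonempty (Fin d) := ⟨⟨0, hd⟩⟩
  set μ : Measure (EuclideanSpace ℂ (Fin d)) := volume
  calc
    ∫ x, G x * (Real.exp (-‖x‖ ^ 2) : ℂ) ∂μ
      = ∫ x : ({(0)}ᶜ : Set (EuclideanSpace ℂ (Fin d))), G x.1 * (Real.exp (-‖x.1‖ ^ 2) : ℂ) ∂(μ.comap (↑)) := by
      rw [integral_subtype_comap (measurableSet_singleton _).compl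
        fun x => G x * (Real.exp (-‖x‖ ^ 2) : ℂ), restrict_compl_singleton]
    _ = ∫ z : UnitSphere d × Set.Ioi (0 : ℝ), G z.1.1 *
          ((z.2.1 ^ (2 * t) * Real.exp (-z.2.1 ^ 2) : ℝ) : ℂ)
          ∂μ.toSphere.prod (.volumeIoiPow (Module.finrank ℝ (EuclideanSpace ℂ (Fin d)) - 1)) := by
      rw [← μ.measurePreserving_homeomorphUnitSphereProd.integral_comp
        (Homeomorph.measurableEmbedding _)]
      refine integral_congr_ae (Eventually.of_forall fun x => ?_)
      have hx : 0 < ‖x.1‖ := norm_pos_iff.2 x.2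
      simp only [homeomorphUnitSphereProd_apply_snd_coe, homeomorphUnitSphereProd_apply_fst_coe]
      rw [hG _ (inv_pos.2 hx)]
      have : (‖x.1‖ : ℂ) ≠ 0 := by exact_mod_cast hx.ne'
      push_cast
      rw [inv_pow]
      field_simp
    _ = (∫ ξ : UnitSphere d, G ξ.1 ∂μ.toSphere) * ∫ r : Set.Ioi (0 : ℝ),
          ((r.1 ^ (2 * t) * Real.exp (-r.1 ^ 2) : ℝ) : ℂ)
          ∂(.volumeIoiPow (Module.finrank ℝ (EuclideanSpace ℂ (Fin d)) - 1)) :=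
      integral_prod_mul (fun ξ : UnitSphere d => G ξ.1)
        (fun r : Set.Ioi (0 : ℝ) => ((r.1 ^ (2 * t) * Real.exp (-r.1 ^ 2) : ℝ) : ℂ))
    _ = _ := by
      congr 1
      rw [integral_complex_ofReal]
      simp only [Measure.volumeIoiPow, ENNReal.ofReal]
      rw [integral_withDensity_eq_integral_smul
          ((measurable_subtype_coe.pow_const _).real_toNNReal),
        integral_subtype_comap measurableSet_Ioi fun a : ℝ =>
          Real.toNNReal (a ^ (Module.finrank ℝ (EuclideanSpace ℂ (Fin d)) - 1)) • (a ^ (2 * t) * Real.exp (-a ^ 2)),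
        -- The Jacobian r^(2d-1) times the homogeneity factor r^(2t).
        setIntegral_congr_fun (g := fun r : ℝ => r ^ (2 * (d + t - 1) + 1) * Real.exp (-r ^ 2))
          measurableSet_Ioi, integral_pow_mul_exp_neg_sq]
      · push_cast
        rfl
      · intro r hr
        have hr : 0 < r := hr
        simp only [NNReal.smul_def, smul_eq_mul]
        rw [Real.coe_toNNReal _ (pow_nonneg hr.le _), ← mul_assoc, ← pow_add,
          finrank_real_euclideanSpace]
        congr 2
        omega

theorem integral_uniformMeasure (G : UnitSphere d → ℂ) :
    ∫ ξ, G ξ ∂uniformMeasure d =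
      (∫ ξ, G ξ ∂(volume : Measure (EuclideanSpace ℂ (Fin d))).toSphere) /
        ∫ _ξ : UnitSphere d, (1 : ℂ) ∂(volume : Measure (EuclideanSpace ℂ (Fin d))).toSphere := by
  rw [uniformMeasure, integral_smul_measure, integral_const, ENNReal.toReal_inv, div_eq_inv_mul,
    Complex.real_smul, Complex.real_smul, Measure.real]
  push_cast
  ring

/-- Moments of the uniform measure on the unit sphere of `ℂ^d`. -/
theorem integral_sphere_monomial (hd : 0 < d) (t : ℕ) (α β : Fin d → ℕ)
    (hα : ∑ i, α i = t) (hβ : ∑ i, β i = t) :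
    ∫ ξ : UnitSphere d, (∏ i, ξ.1 i ^ α i * star (ξ.1 i) ^ β i) ∂uniformMeasure d =
      if α = β then ((d - 1).factorial / (d + t - 1).factorial : ℂ) * ∏ i, ((α i).factorial : ℂ)
      else 0 := by
  obtain ⟨c, hc, hmon⟩ := exists_integral_monomial d
  -- Degree 0 gives the total mass of the sphere in terms of the same constant `c`.
  have h0 := integral_homogeneous_mul_exp hd 0 (fun _ => 1) (by simp)
  have h0' := hmon 0 0
  simp only [Pi.zero_apply, pow_zero, mul_one, Finset.prod_const_one, if_true, Nat.factorial_zero,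
    Nat.cast_one, add_zero] at h0' h0
  rw [h0'] at h0
  have h1 := integral_homogeneous_mul_exp hd t
    (fun x => ∏ i, x i ^ α i * star (x i) ^ β i) (by
      intro r _ x
      have : ∀ i, (r • x) i ^ α i * star ((r • x) i) ^ β i =
          ((r : ℂ) ^ α i * (r : ℂ) ^ β i) * (x i ^ α i * star (x i) ^ β i) := fun i => by
        simp only [PiLp.smul_apply, Complex.real_smul, star_mul, mul_pow, Complex.star_def,
          Complex.conj_ofReal]
        ring
      simp only [this]
      rw [Finset.prod_mul_distrib, Finset.prod_mul_distrib, Finset.prod_pow_eq_pow_sum,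
        Finset.prod_pow_eq_pow_sum, hα, hβ]
      ring)
  rw [hmon] at h1
  rw [integral_uniformMeasure]
  have f1 : ((d - 1).factorial : ℂ) ≠ 0 := by exact_mod_cast Nat.factorial_ne_zero _
  have f2 : ((d + t - 1).factorial : ℂ) ≠ 0 := by exact_mod_cast Nat.factorial_ne_zero _
  have hS : (∫ _ξ : UnitSphere d, (1 : ℂ)
      ∂(volume : Measure (EuclideanSpace ℂ (Fin d))).toSphere) ≠ 0 := by
    intro h
    rw [h, zero_mul] at h0
    exact hc h0
  rw [div_eq_iff hS]
  split_ifs at h1 ⊢ with h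
  · have h2 : (∫ _ξ : UnitSphere d, (1 : ℂ)
      ∂(volume : Measure (EuclideanSpace ℂ (Fin d))).toSphere) = 2 * c / (d - 1).factorial := by
      rw [eq_div_iff f1]
      linear_combination -2 * h0
    rw [h2]
    refine mul_right_cancel₀ f2 ?_
    field_simp
    linear_combination -2 * h1
  · have := mul_eq_zero.1 h1.symm
    rcases this with h | h
    · rw [h, zero_mul]
    · exact absurd h (by simp [f2])

/-- A function on the sphere extends to a radially constant one on ℂ^d, and both Lebesgue measure
and the Gaussian weight are invariant under isometries. -/
theorem integral_uniformMeasure_comp_isometry (hd : 0 < d)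
    (U : EuclideanSpace ℂ (Fin d) ≃ₗᵢ[ℝ] EuclideanSpace ℂ (Fin d))
    (F : EuclideanSpace ℂ (Fin d) → ℂ) :
    ∫ ξ : UnitSphere d, F (U ξ.1) ∂uniformMeasure d = ∫ ξ : UnitSphere d, F ξ.1 ∂uniformMeasure d := by
  have hom : ∀ F' : EuclideanSpace ℂ (Fin d) → ℂ, ∀ r : ℝ, 0 < r → ∀ x : EuclideanSpace ℂ (Fin d),
      F' (‖r • x‖⁻¹ • (r • x)) = (r : ℂ) ^ (2 * 0) * F' (‖x‖⁻¹ • x) := fun F' r hr x => by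
    rw [norm_smul, Real.norm_of_nonneg hr.le, smul_smul, mul_inv, mul_right_comm,
      inv_mul_cancel₀ hr.ne']
    simp
  have key : ∀ F' : EuclideanSpace ℂ (Fin d) → ℂ,
      ∫ x : EuclideanSpace ℂ (Fin d), F' (‖x‖⁻¹ • x) * (Real.exp (-‖x‖ ^ 2) : ℂ) =
      (∫ ξ : UnitSphere d, F' ξ.1 ∂(volume : Measure (EuclideanSpace ℂ (Fin d))).toSphere) *
        ((d + 0 - 1).factorial / 2 : ℂ) := fun F' => by
    rw [integral_homogeneous_mul_exp hd 0 (fun x => F' (‖x‖⁻¹ • x)) (hom F')]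
    congr 1
    exact integral_congr_ae (Eventually.of_forall fun ξ => by simp)
  have h := U.measurePreserving.integral_comp U.toHomeomorph.measurableEmbedding
    (fun x => F (‖x‖⁻¹ • x) * (Real.exp (-‖x‖ ^ 2) : ℂ))
  simp only [LinearIsometryEquiv.norm_map] at h
  have h2 : ∫ x : EuclideanSpace ℂ (Fin d), F (‖x‖⁻¹ • U x) * (Real.exp (-‖x‖ ^ 2) : ℂ) =
      ∫ x : EuclideanSpace ℂ (Fin d), F (U (‖x‖⁻¹ • x)) * (Real.exp (-‖x‖ ^ 2) : ℂ) := by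
    simp only [map_smul]
  rw [h2, key (fun x => F (U x)), key F] at h
  have f1 : ((d + 0 - 1).factorial / 2 : ℂ) ≠ 0 :=
    div_ne_zero (by exact_mod_cast Nat.factorial_ne_zero _) two_ne_zero
  rw [integral_uniformMeasure, integral_uniformMeasure, mul_right_cancel₀ f1 h]

end Sphere

/-! ### Second and fourth moments of the measurement outcome -/

section Moments

variable {d : ℕ}

instance isFiniteMeasure_uniformMeasure (d : ℕ) : IsFiniteMeasure (uniformMeasure d) := by
  by_cases hd : (volume : Measure (EuclideanSpace ℂ (Fin d))).toSphere = 0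
  · rw [uniformMeasure, hd, smul_zero]
    infer_instance
  · refine ⟨?_⟩
    have h0 : (volume : Measure (EuclideanSpace ℂ (Fin d))).toSphere Set.univ ≠ 0 := by
      rwa [Ne, Measure.measure_univ_eq_zero]
    rw [uniformMeasure, Measure.smul_apply, smul_eq_mul,
      ENNReal.inv_mul_cancel h0 (measure_ne_top _ _)]
    exact ENNReal.one_lt_top

theorem integrable_uniformMeasure {f : UnitSphere d → ℂ} (hf : Continuous f) :
    Integrable f (uniformMeasure d) :=
  hf.integrable_of_hasCompactSupport (HasCompactSupport.of_compactSpace _)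

/-- The Kronecker delta. -/
def delta (i j : Fin d) : ℂ := if i = j then 1 else 0

theorem delta_comm (i j : Fin d) : delta i j = delta j i := by
  simp only [delta, eq_comm]

theorem sum_mul_delta (f : Fin d → ℂ) (j : Fin d) : ∑ k, f k * delta k j = f j := by
  simp [delta]

theorem sum_delta_self : ∑ k : Fin d, delta k k = d := by
  simp [delta]

theorem delta_self (i : Fin d) : delta i i = 1 := if_pos rfl

/-- The coordinate functions on the sphere. -/
def coord (i : Fin d) : C(UnitSphere d, ℂ) := ⟨fun ξ => ξ.1 i, by fun_prop⟩

theorem sum_coord_mul_star : ∑ k : Fin d, coord k * star (coord k) = 1 := by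
  ext ξ
  have h : ‖ξ.1‖ ^ 2 = 1 := by simp
  rw [norm_sq_eq_sum] at h
  simp only [ContinuousMap.coe_sum, Finset.sum_apply, ContinuousMap.mul_apply,
    ContinuousMap.star_apply, coord, ContinuousMap.coe_mk, ContinuousMap.one_apply]
  simp only [Complex.star_def, Complex.mul_conj, Complex.normSq_eq_norm_sq]
  exact_mod_cast h

/-- The mean of a function of the measurement outcome `ξ`, when measuring `n` copies of the
basis state `o`. -/
def outcomeMean (n : ℕ) (o : Fin d) : C(UnitSphere d, ℂ) →ₗ[ℂ] ℂ where
  toFun f := symProjTrace d n * ∫ ξ : UnitSphere d,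
    ((‖inner ℂ ξ.1 (EuclideanSpace.single o (1 : ℂ))‖ ^ (2 * n) : ℝ) : ℂ) * f ξ ∂uniformMeasure d
  map_add' f g := by
    rw [← mul_add, ← integral_add]
    · simp only [ContinuousMap.add_apply, mul_add]
    all_goals exact integrable_uniformMeasure (by fun_prop)
  map_smul' c f := by
    simp only [ContinuousMap.smul_apply, smul_eq_mul, RingHom.id_apply]
    rw [mul_left_comm, ← integral_const_mul c]
    simp only [mul_left_comm c]

theorem prod_pow_single (z : Fin d → ℂ) (o : Fin d) (n : ℕ) :
    ∏ t, z t ^ (Pi.single o n : Fin d → ℕ) t = z o ^ n := by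
  rw [Finset.prod_eq_single o]
  · simp
  · intro b _ hb
    simp [hb]
  · simp

theorem prod_factorial_add_single (f : Fin d → ℕ) (i : Fin d) :
    ∏ t, (((f + Pi.single i 1 : Fin d → ℕ) t).factorial : ℂ) =
      (f i + 1) * ∏ t, ((f t).factorial : ℂ) := by
  have h : ∀ t, (((f + Pi.single i 1 : Fin d → ℕ) t).factorial : ℂ) =
      (if t = i then (f i + 1 : ℂ) else 1) * ((f t).factorial : ℂ) := fun t => by
    by_cases ht : t = i
    · subst ht
      simp [Nat.factorial_succ]
    · simp [ht]
  simp only [h]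
  rw [Finset.prod_mul_distrib, Finset.prod_ite_eq' Finset.univ i]
  simp

theorem prod_factorial_single (o : Fin d) (n : ℕ) :
    ∏ t, (((Pi.single o n : Fin d → ℕ) t).factorial : ℂ) = n.factorial := by
  rw [Finset.prod_eq_single o]
  · simp
  · intro b _ hb
    simp [hb]
  · simp

theorem single_add_single_eq_iff (f : Fin d → ℕ) (i j k l : Fin d) :
    f + Pi.single i 1 + Pi.single k 1 = f + Pi.single j 1 + Pi.single l 1 ↔
      (i = j ∧ k = l) ∨ (i = l ∧ k = j) := by
  constructor
  · intro h
    by_cases hij : i = j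
    · subst hij
      have hk := congrFun (add_left_cancel h) k
      exact Or.inl ⟨rfl, by simpa [Pi.single_apply] using hk⟩
    · have hil : i = l := by
        have hi := congrFun h i
        simp only [Pi.add_apply, Pi.single_apply, if_neg hij] at hi
        by_contra hil
        simp only [if_true, if_neg hil] at hi
        omega
      subst hil
      rw [add_right_comm] at h
      have hk := congrFun (add_left_cancel (add_right_cancel h)) k
      exact Or.inr ⟨rfl, by simpa [Pi.single_apply] using hk⟩
  · rintro (⟨rfl, rfl⟩ | ⟨rfl, rfl⟩)
    · rfl
    · rw [add_right_comm]

/-- Turns the factorials of the occupation numbers, supported on the two pairings of (i,k) with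
(j,l), into a polynomial in deltas that can be summed linearly. -/
theorem ite_pairing_eq (n : ℂ) (o i j k l : Fin d) :
    (if (i = j ∧ k = l) ∨ (i = l ∧ k = j) then
      (n * delta k o + delta i k + 1) * (n * delta i o + 1) else 0) =
      delta i j * delta k l + delta i l * delta j k +
        n * (delta i o * delta j o * delta k l + delta i j * (delta k o * delta l o) +
          delta i o * delta l o * delta j k + delta i l * (delta j o * delta k o)) +
        n * (n - 1) * (delta i o * delta j o * (delta k o * delta l o)) := by
  unfold delta
  by_cases h1 : i = j
  · subst h1
    by_cases h2 : k = l
    · subst h2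
      by_cases h3 : i = k
      · subst h3
        by_cases h5 : i = o
        all_goals simp [h5]
        all_goals ring
      · have h3' : k ≠ i := fun h => h3 h.symm
        by_cases h5 : i = o <;> by_cases h6 : k = o <;> simp_all <;> ring
    · have h2' : l ≠ k := fun h => h2 h.symm
      by_cases h5 : i = o <;> by_cases h6 : k = o <;> by_cases h7 : l = o <;> grind
  · by_cases h2 : i = l
    · subst h2
      by_cases h3 : k = j
      · subst h3
        by_cases h5 : i = o <;> by_cases h6 : k = o <;> simp_all <;> ring
      · have h3' : j ≠ k := fun h => h3 h.symm
        by_cases h5 : i = o <;> by_cases h6 : k = o <;> by_cases h7 : j = o <;> simp_all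
    · by_cases h5 : i = o <;> by_cases h7 : j = o <;> by_cases h8 : l = o <;>
        simp_all [eq_comm]

theorem outcomeMean_quartic (hd : 0 < d) (n : ℕ) (o i j k l : Fin d) :
    ((n + d) * (n + d + 1) : ℂ) *
        outcomeMean n o (coord i * star (coord j) * (coord k * star (coord l))) =
      delta i j * delta k l + delta i l * delta j k +
        n * (delta i o * delta j o * delta k l + delta i j * (delta k o * delta l o) +
          delta i o * delta l o * delta j k + delta i l * (delta j o * delta k o)) +
        n * (n - 1) * (delta i o * delta j o * (delta k o * delta l o)) := by
  -- The weight |ξ_o|^{2n} contributes ξ_o^n and its conjugate, hence `n` at `o` in both exponents.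
  let α : Fin d → ℕ := Pi.single o n + Pi.single i 1 + Pi.single k 1
  let β : Fin d → ℕ := Pi.single o n + Pi.single j 1 + Pi.single l 1
  have hα : ∑ t, α t = n + 2 := by simp [α, Finset.sum_add_distrib]
  have hβ : ∑ t, β t = n + 2 := by simp [β, Finset.sum_add_distrib]
  have e : ∀ ξ : UnitSphere d,
      ((‖inner ℂ ξ.1 (EuclideanSpace.single o (1 : ℂ))‖ ^ (2 * n) : ℝ) : ℂ) *
      (coord i * star (coord j) * (coord k * star (coord l))) ξ =
      ∏ t, ξ.1 t ^ α t * star (ξ.1 t) ^ β t := fun ξ => by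
    have h1 : ((‖inner ℂ ξ.1 (EuclideanSpace.single o (1 : ℂ))‖ ^ (2 * n) : ℝ) : ℂ) =
        ξ.1 o ^ n * star (ξ.1 o) ^ n := by
      rw [EuclideanSpace.inner_single_right, one_mul, Complex.norm_conj, ← mul_pow,
        Complex.star_def, Complex.mul_conj, Complex.normSq_eq_norm_sq, pow_mul]
      push_cast
      rfl
    rw [h1, Finset.prod_mul_distrib]
    simp only [α, β, Pi.add_apply, pow_add, Finset.prod_mul_distrib]
    rw [prod_pow_single (fun t => ξ.1 t), prod_pow_single (fun t => ξ.1 t),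
      prod_pow_single (fun t => ξ.1 t), prod_pow_single (fun t => star (ξ.1 t)),
      prod_pow_single (fun t => star (ξ.1 t)), prod_pow_single (fun t => star (ξ.1 t))]
    simp only [ContinuousMap.mul_apply, ContinuousMap.star_apply, coord, ContinuousMap.coe_mk]
    ring
  -- With tr P_n = (d+n-1)!/(n!(d-1)!), the normalization collapses to 1/((n+d)(n+d+1)).
  have hpre : ((n + d) * (n + d + 1) : ℂ) * (((d + n - 1).choose n : ℂ) *
      ((d - 1).factorial / (d + (n + 2) - 1).factorial * n.factorial)) = 1 := by
    have h1 := Nat.choose_mul_factorial_mul_factorial (show n ≤ d + n - 1 by omega)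
    have h2 : (d + (n + 2) - 1).factorial = (d + n + 1) * ((d + n) * (d + n - 1).factorial) := by
      rw [show d + (n + 2) - 1 = d + n + 1 by omega, Nat.factorial_succ,
        Nat.mul_factorial_pred (by omega)]
    rw [show d + n - 1 - n = d - 1 by omega] at h1
    have h3 : (((d + n - 1).factorial : ℕ) : ℂ) ≠ 0 := by exact_mod_cast Nat.factorial_ne_zero _
    have h4 : ((d : ℂ) + n) ≠ 0 := by exact_mod_cast (by omega : d + n ≠ 0)
    have h5 : ((d : ℂ) + n + 1) ≠ 0 := by exact_mod_cast (by omega : d + n + 1 ≠ 0)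
    rw [h2, ← h1] at *
    push_cast at h3 ⊢
    have h6 := left_ne_zero_of_mul h3
    have h7 := right_ne_zero_of_mul h3
    have h8 := left_ne_zero_of_mul h6
    have h9 := right_ne_zero_of_mul h6
    field_simp
    ring
  change _ * (symProjTrace d n * _) = _
  simp only [e]
  rw [integral_sphere_monomial hd (n + 2) α β hα hβ, symProjTrace_eq_choose]
  have hfac : ∏ t, ((α t).factorial : ℂ) =
      (n * delta k o + delta i k + 1) * ((n * delta i o + 1) * n.factorial) := by
    rw [prod_factorial_add_single, prod_factorial_add_single, prod_factorial_single]
    simp only [Pi.add_apply, Pi.single_apply, delta]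
    push_cast
    simp only [eq_comm (a := k) (b := i), mul_ite, mul_one, mul_zero]
  rw [hfac]
  have hcond : (α = β) = ((i = j ∧ k = l) ∨ (i = l ∧ k = j)) :=
    propext (single_add_single_eq_iff _ _ _ _ _)
  simp only [hcond]
  have hsplit : ∀ c : Prop, [Decidable c] → ∀ x y : ℂ,
      ((n + d) * (n + d + 1) : ℂ) * (((d + n - 1).choose n : ℂ) *
        (if c then (d - 1).factorial / (d + (n + 2) - 1).factorial * (x * (y * n.factorial))
          else 0)) = if c then x * y else 0 := fun c _ x y => by
    split_ifs
    · linear_combination x * y * hpre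
    · simp
  rw [hsplit]
  exact ite_pairing_eq n o i j k l

theorem outcomeMean_quadratic (hd : 0 < d) (n : ℕ) (o i j : Fin d) :
    ((n + d) : ℂ) * outcomeMean n o (coord i * star (coord j)) =
      delta i j + n * (delta i o * delta j o) := by
  -- Inserting 1 = ∑ |ξ_k|² obtains the second moment by contracting the fourth.
  have h : outcomeMean n o (coord i * star (coord j)) =
      ∑ k, outcomeMean n o (coord i * star (coord j) * (coord k * star (coord k))) := by
    rw [← map_sum, ← Finset.mul_sum, sum_coord_mul_star, mul_one]
  have h5 : ((n : ℂ) + d + 1) ≠ 0 := by exact_mod_cast (by omega : n + d + 1 ≠ 0)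
  refine mul_right_cancel₀ h5 ?_
  rw [h, mul_right_comm, Finset.mul_sum]
  simp only [outcomeMean_quartic hd]
  have e : ∀ k : Fin d, delta i j * delta k k + delta i k * delta j k +
        n * (delta i o * delta j o * delta k k + delta i j * (delta k o * delta k o) +
          delta i o * delta k o * delta j k + delta i k * (delta j o * delta k o)) +
        n * (n - 1) * (delta i o * delta j o * (delta k o * delta k o)) =
      (delta i j + n * (delta i o * delta j o)) * delta k k + delta i k * delta k j +
        (n * delta i j * delta k o + n * (n - 1) * delta i o * delta j o * delta k o) * delta k o +
        n * delta i o * delta k o * delta k j + n * delta j o * delta k o * delta k i := fun k => by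
    rw [delta_comm j k, delta_comm k i]
    ring
  simp only [e, Finset.sum_add_distrib, sum_mul_delta]
  rw [← Finset.mul_sum, sum_delta_self, delta_self]
  ring

theorem outcomeMean_one (hd : 0 < d) (n : ℕ) (o : Fin d) : outcomeMean n o 1 = 1 := by
  have h5 : ((n : ℂ) + d) ≠ 0 := by exact_mod_cast (by omega : n + d ≠ 0)
  refine mul_left_cancel₀ h5 ?_
  rw [← sum_coord_mul_star, map_sum, Finset.mul_sum]
  simp only [outcomeMean_quadratic hd, Finset.sum_add_distrib, sum_delta_self]
  rw [← Finset.mul_sum, sum_mul_delta, delta_self]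
  ring

end Moments

/-! ### Unitary covariance and reduction to a basis vector -/

section Covariance

variable {d : ℕ}

theorem reflection_eq (ξ : EuclideanSpace ℂ (Fin d)) :
    reflection ξ = 1 - (2 : ℂ) • rankOne ξ ξ := rfl

theorem reflection_act {U : Op (Fin d)} (hU : Uᴴ * U = 1) (ξ : EuclideanSpace ℂ (Fin d)) :
    reflection (act U ξ) = U * reflection ξ * Uᴴ := by
  have hU' : U * Uᴴ = 1 := mul_eq_one_comm.1 hU
  have h := mul_rankOne_mul U Uᴴ ξ ξ
  rw [Matrix.conjTranspose_conjTranspose] at h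
  rw [reflection_eq, reflection_eq, mul_sub, sub_mul, mul_one, hU', Matrix.mul_smul,
    Matrix.smul_mul, h]

theorem reflectionChannel_act {U : Op (Fin d)} (hU : Uᴴ * U = 1) (ξ : EuclideanSpace ℂ (Fin d))
    (X : Op (Fin d)) :
    reflectionChannel (act U ξ) X = U * reflectionChannel ξ (Uᴴ * X * U) * Uᴴ := by
  simp only [reflectionChannel, LinearMap.coe_mk, AddHom.coe_mk, reflection_act hU,
    Matrix.conjTranspose_mul, Matrix.conjTranspose_conjTranspose, mul_assoc]

/-- A unitary matrix as a real-linear isometry. -/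
def actIsometry {U : Op (Fin d)} (hU : Uᴴ * U = 1) :
    EuclideanSpace ℂ (Fin d) ≃ₗᵢ[ℝ] EuclideanSpace ℂ (Fin d) :=
  LinearIsometry.toLinearIsometryEquiv
    { toFun := act U
      map_add' := fun x y => by simp [act, Matrix.mulVec_add]
      map_smul' := fun c x => by simp [act, Matrix.mulVec_smul]
      norm_map' := norm_act_of_unitary hU } rfl

theorem actIsometry_apply {U : Op (Fin d)} (hU : Uᴴ * U = 1) (x : EuclideanSpace ℂ (Fin d)) :
    actIsometry hU x = act U x := rfl

theorem inner_act_act {U : Op (Fin d)} (hU : Uᴴ * U = 1) (x y : EuclideanSpace ℂ (Fin d)) :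
    inner ℂ (act U x) (act U y) = inner ℂ x y := by
  rw [inner_act_left, ← act_mul, hU]
  simp [act]

theorem measureAndReflect_act (hd : 0 < d) {U : Op (Fin d)} (hU : Uᴴ * U = 1) (n : ℕ)
    (ψ : EuclideanSpace ℂ (Fin d)) (X : Op (Fin d)) :
    measureAndReflect n (act U ψ) X = U * measureAndReflect n ψ (Uᴴ * X * U) * Uᴴ := by
  simp only [measureAndReflect, LinearMap.coe_mk, AddHom.coe_mk, Matrix.mul_smul, Matrix.smul_mul]
  congr 1
  ext i j
  have h := integral_uniformMeasure_comp_isometry hd (actIsometry hU)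
    (fun ξ => ((‖inner ℂ ξ (act U ψ)‖ ^ (2 * n) : ℝ) : ℂ) * reflectionChannel ξ X i j)
  simp only [actIsometry_apply, inner_act_act hU, reflectionChannel_act hU] at h
  rw [Matrix.of_apply, ← h]
  simp only [Matrix.mul_apply, Matrix.of_apply, Finset.mul_sum, Finset.sum_mul]
  have hint : ∀ a b : Fin d, Integrable (fun ξ : UnitSphere d =>
      ((‖inner ℂ ξ.1 ψ‖ ^ (2 * n) : ℝ) : ℂ) *
        (U i b * reflectionChannel ξ.1 (Uᴴ * X * U) b a * Uᴴ a j)) (uniformMeasure d) :=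
    fun a b => by
      have := ((integrable_entry n ψ (Uᴴ * X * U) b a).const_mul (U i b)).mul_const (Uᴴ a j)
      refine this.congr (Eventually.of_forall fun ξ => ?_)
      simp only
      ring
  rw [integral_finsetSum _ fun a _ => integrable_finsetSum _ fun b _ => hint a b]
  refine Finset.sum_congr rfl fun a _ => ?_
  rw [integral_finsetSum _ fun b _ => hint a b]
  refine Finset.sum_congr rfl fun b _ => ?_
  rw [← integral_const_mul, ← integral_mul_const]
  refine integral_congr_ae (Eventually.of_forall fun ξ => ?_)
  simp only
  ring

/-- The diamond distance does not depend on the unit vector. -/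
theorem mrDistance_act (hd : 0 < d) {U : Op (Fin d)} (hU : Uᴴ * U = 1) (n : ℕ)
    (ψ : EuclideanSpace ℂ (Fin d)) : mrDistance n (act U ψ) = mrDistance n ψ := by
  refine diamondNorm_conj _ _ hU fun X => ?_
  rw [LinearMap.sub_apply, LinearMap.sub_apply, measureAndReflect_act hd hU,
    reflectionChannel_act hU, mul_sub, sub_mul]

theorem exists_unitary_act_single (o : Fin d) {ψ : EuclideanSpace ℂ (Fin d)} (hψ : ‖ψ‖ = 1) :
    ∃ U : Op (Fin d), Uᴴ * U = 1 ∧ act U (EuclideanSpace.single o 1) = ψ := by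
  -- ψ is placed at position `o` and completed to an orthonormal basis; the columns of `U` are this
  -- basis.
  have hv : Orthonormal ℂ (({o} : Set (Fin d)).domRestrict fun _ => ψ) := by
    refine ⟨fun _ => hψ, fun i j hij => absurd (Subsingleton.elim i j) hij⟩
  obtain ⟨b, hb⟩ := Orthonormal.exists_orthonormalBasis_extension_of_card_eq (by simp) hv
  refine ⟨Matrix.of fun i j => b j i, ?_, ?_⟩
  · ext i j
    have := orthonormal_iff_ite.1 b.orthonormal i j
    rw [inner_eq_sum] at this
    simp only [Matrix.mul_apply, Matrix.conjTranspose_apply, Matrix.of_apply, Matrix.one_apply]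
    exact this
  · ext i
    rw [← hb o rfl, act_apply]
    simp [PiLp.single_apply]

theorem mrDistance_eq_single (hd : 0 < d) (o : Fin d) {ψ : EuclideanSpace ℂ (Fin d)}
    (hψ : ‖ψ‖ = 1) (n : ℕ) :
    mrDistance n ψ = mrDistance n (EuclideanSpace.single o (1 : ℂ)) := by
  obtain ⟨U, hU, rfl⟩ := exists_unitary_act_single o hψ
  exact mrDistance_act hd hU n _

end Covariance

/-! ### Explicit kernel of the difference of the two channels -/

section Kernel

variable {d : ℕ}

theorem reflection_apply (ξ : EuclideanSpace ℂ (Fin d)) (i j : Fin d) :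
    reflection ξ i j = delta i j - 2 * (ξ i * star (ξ j)) := rfl

theorem star_delta (i j : Fin d) : star (delta i j) = delta i j := by
  simp only [delta]
  split_ifs <;> simp

theorem reflectionChannel_apply (ξ : EuclideanSpace ℂ (Fin d)) (X : Op (Fin d)) (i l : Fin d) :
    reflectionChannel ξ X i l = ∑ j, ∑ k,
      (delta i j - 2 * (ξ i * star (ξ j))) * (delta k l - 2 * (ξ k * star (ξ l))) * X j k := by
  simp only [reflectionChannel, LinearMap.coe_mk, AddHom.coe_mk, Matrix.mul_apply,
    Matrix.conjTranspose_apply, reflection_apply, star_sub, star_mul, star_star, star_delta,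
    Finset.sum_mul]
  rw [Finset.sum_comm]
  refine Finset.sum_congr rfl fun j _ => Finset.sum_congr rfl fun k _ => ?_
  rw [delta_comm l k, star_ofNat]
  ring

theorem measureAndReflect_apply (n : ℕ) (o : Fin d) (X : Op (Fin d)) (i l : Fin d) :
    measureAndReflect n (EuclideanSpace.single o 1) X i l = ∑ j, ∑ k,
      outcomeMean n o ((delta i j * delta k l) • 1 - (2 * delta i j) • (coord k * star (coord l))
        - (2 * delta k l) • (coord i * star (coord j))
        + (4 : ℂ) • (coord i * star (coord j) * (coord k * star (coord l)))) * X j k := by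
  have h : measureAndReflect n (EuclideanSpace.single o 1) X i l =
      outcomeMean n o (∑ j, ∑ k, X j k • ((delta i j * delta k l) • 1
        - (2 * delta i j) • (coord k * star (coord l))
        - (2 * delta k l) • (coord i * star (coord j))
        + (4 : ℂ) • (coord i * star (coord j) * (coord k * star (coord l))))) := by
    simp only [measureAndReflect, outcomeMean, LinearMap.coe_mk, AddHom.coe_mk, Matrix.smul_apply,
      Matrix.of_apply, smul_eq_mul]
    congr 1
    refine integral_congr_ae (Eventually.of_forall fun ξ => ?_)
    simp only [reflectionChannel_apply]
    congr 1
    simp only [ContinuousMap.coe_sum, Finset.sum_apply, ContinuousMap.smul_apply,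
      ContinuousMap.add_apply, ContinuousMap.sub_apply, ContinuousMap.mul_apply,
      ContinuousMap.star_apply, coord, ContinuousMap.coe_mk, ContinuousMap.one_apply, smul_eq_mul]
    refine Finset.sum_congr rfl fun j _ => Finset.sum_congr rfl fun k _ => ?_
    ring
  rw [h]
  simp only [map_sum, map_smul, smul_eq_mul]
  refine Finset.sum_congr rfl fun j _ => Finset.sum_congr rfl fun k _ => mul_comm _ _

/-- The kernel of `measureAndReflect - reflectionChannel`, up to the factor
`4 / ((n + d) (n + d + 1))`. -/
def diffKernel (n : ℕ) (o i j k l : Fin d) : ℂ :=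
  -(n + d) * (delta i j * delta k l)
    + ((n + d + 1) * d / 2 + n) * (delta i o * delta j o * delta k l
      + delta i j * (delta k o * delta l o))
    + (n * (n - 1) - (n + d) * (n + d + 1)) * (delta i o * delta j o * (delta k o * delta l o))
    + delta i l * delta j k + n * (delta i o * delta l o * delta j k)
    + n * (delta i l * (delta j o * delta k o))

theorem difference_apply (hd : 0 < d) (n : ℕ) (o : Fin d) (X : Op (Fin d)) (i l : Fin d) :
    (measureAndReflect n (EuclideanSpace.single o 1) -
      reflectionChannel (EuclideanSpace.single o (1 : ℂ))) X i l =
      ∑ j, ∑ k, 4 / ((n + d) * (n + d + 1)) * diffKernel n o i j k l * X j k := by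
  rw [LinearMap.sub_apply, Matrix.sub_apply, measureAndReflect_apply, reflectionChannel_apply,
    ← Finset.sum_sub_distrib]
  refine Finset.sum_congr rfl fun j _ => ?_
  rw [← Finset.sum_sub_distrib]
  refine Finset.sum_congr rfl fun k _ => ?_
  have hs : ∀ a, (EuclideanSpace.single o (1 : ℂ)) a = delta a o := fun a => by
    simp [PiLp.single_apply, delta]
  simp only [hs, star_delta, map_add, map_sub, map_smul, smul_eq_mul, outcomeMean_one hd]
  rw [← sub_mul]
  congr 1
  have h4 : ((n : ℂ) + d) ≠ 0 := by exact_mod_cast (by omega : n + d ≠ 0)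
  have h5 : ((n : ℂ) + d + 1) ≠ 0 := by exact_mod_cast (by omega : n + d + 1 ≠ 0)
  have q1 := outcomeMean_quadratic hd n o i j
  have q2 := outcomeMean_quadratic hd n o k l
  have q3 := outcomeMean_quartic hd n o i j k l
  rw [div_mul_eq_mul_div, eq_div_iff (mul_ne_zero h4 h5), diffKernel]
  linear_combination 4 * q3 - 2 * delta i j * (n + d + 1) * q2 - 2 * delta k l * (n + d + 1) * q1

end Kernel

/-! ### Signed operator-sum representation and the upper bound -/

section OperatorSum

variable {d : ℕ}

/-- The entries of the projection onto the orthogonal complement of the basis vector `o`. -/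
def compl (o i j : Fin d) : ℂ := delta i j - delta i o * delta j o

theorem compl_comm (o i j : Fin d) : compl o i j = compl o j i := by
  rw [compl, compl, delta_comm i j, mul_comm]

theorem star_compl (o i j : Fin d) : star (compl o i j) = compl o i j := by
  rw [compl, star_sub, star_mul, star_delta, star_delta, star_delta, mul_comm]

theorem sum_mul_compl (f : Fin d → ℂ) (o j : Fin d) :
    ∑ k, f k * compl o k j = f j - f o * delta j o := by
  simp only [compl, mul_sub, Finset.sum_sub_distrib, sum_mul_delta]
  congr 1
  simp only [← mul_assoc, ← Finset.sum_mul, sum_mul_delta]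

theorem compl_self_right (o i : Fin d) : compl o i o = 0 := by
  rw [compl, delta_self, mul_one, sub_self]

theorem sum_compl_mul_compl (o i j : Fin d) : ∑ k, compl o i k * compl o k j = compl o i j := by
  rw [sum_mul_compl, compl_self_right, zero_mul, sub_zero]

theorem sum_compl_self (o : Fin d) : ∑ k, compl o k k = (d : ℂ) - 1 := by
  simp only [compl, Finset.sum_sub_distrib, sum_delta_self, sum_mul_delta]
  rw [delta_self]

/-- The operators of a signed operator-sum representation of
`measureAndReflect - reflectionChannel`. -/
def kraus (o : Fin d) (x y : ℝ) : (Fin d ⊕ Fin d) ⊕ ((Fin d × Fin d) ⊕ Bool) → Op (Fin d)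
  | .inl (.inl a) => Matrix.of fun i j => delta i o * compl o a j
  | .inl (.inr a) => Matrix.of fun i j => compl o i a * delta j o
  | .inr (.inl (a, b)) => Matrix.of fun i j =>
      compl o i a * compl o b j - compl o a b * compl o i j / ((d : ℂ) - 1)
  | .inr (.inr true) => Matrix.of fun i j => compl o i j
  | .inr (.inr false) => Matrix.of fun i j => x * (delta i o * delta j o) + y * compl o i j

/-- The weights of the operators `kraus`. -/
def krausWeight (d : ℕ) (c β ε : ℝ) : (Fin d ⊕ Fin d) ⊕ ((Fin d × Fin d) ⊕ Bool) → ℝ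
  | .inl _ => c
  | .inr (.inl _) => 1
  | .inr (.inr true) => β
  | .inr (.inr false) => ε

/-- The operators are the P|a⟩⟨b|P with their trace part removed. Projecting out the span of P,
whose squared Hilbert-Schmidt norm is d-1, subtracts the rank-one kernel of P/√(d-1). -/
theorem sum_traceless_kernel (hd : 2 ≤ d) (o i j k l : Fin d) :
    ∑ a, ∑ b, (compl o i a * compl o b j - compl o a b * compl o i j / ((d : ℂ) - 1)) *
        (compl o l a * compl o b k - compl o a b * compl o l k / ((d : ℂ) - 1)) =
      compl o i l * compl o j k - compl o i j * compl o l k / ((d : ℂ) - 1) := by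
  have hm : ((d : ℂ) - 1) ≠ 0 := by
    rw [sub_ne_zero]
    exact_mod_cast (by omega : d ≠ 1)
  have hb : ∀ a, ∑ b, (compl o i a * compl o b j - compl o a b * compl o i j / ((d : ℂ) - 1)) *
        (compl o l a * compl o b k - compl o a b * compl o l k / ((d : ℂ) - 1)) =
      compl o j k * (compl o i a * compl o a l)
        - compl o l k / ((d : ℂ) - 1) * (compl o i a * compl o a j)
        - compl o i j / ((d : ℂ) - 1) * (compl o l a * compl o a k)
        + compl o i j * compl o l k / ((d : ℂ) - 1) ^ 2 * compl o a a := fun a => by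
    rw [← sum_compl_mul_compl o j k, ← sum_compl_mul_compl o a j, ← sum_compl_mul_compl o a k,
      ← sum_compl_mul_compl o a a]
    simp only [Finset.mul_sum, Finset.sum_mul, ← Finset.sum_add_distrib, ← Finset.sum_sub_distrib]
    refine Finset.sum_congr rfl fun b _ => ?_
    rw [compl_comm o b a, compl_comm o j b, compl_comm o l a]
    field_simp
    ring
  simp only [hb, Finset.sum_add_distrib, Finset.sum_sub_distrib, ← Finset.mul_sum,
    sum_compl_mul_compl, sum_compl_self]
  field_simp
  ring

theorem sum_kraus_kernel (hd : 2 ≤ d) (o : Fin d) (x y c β ε : ℝ) (i j k l : Fin d) :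
    ∑ a, (krausWeight d c β ε a : ℂ) * (kraus o x y a i j * star (kraus o x y a l k)) =
      c * (delta i o * delta l o * compl o j k + compl o i l * (delta j o * delta k o)) +
        (compl o i l * compl o j k - compl o i j * compl o l k / ((d : ℂ) - 1)) +
        β * (compl o i j * compl o l k) +
        ε * ((x * (delta i o * delta j o) + y * compl o i j) *
          (x * (delta l o * delta k o) + y * compl o l k)) := by
  have hsd : star ((d : ℂ) - 1) = (d : ℂ) - 1 := by simp
  have hsr : ∀ r : ℝ, star (r : ℂ) = r := fun r => Complex.conj_ofReal r
  simp only [Fintype.sum_sum_type, Fintype.sum_prod_type, Fintype.sum_bool, kraus, krausWeight,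
    Matrix.of_apply, star_sub, star_add, star_mul, star_div₀, star_compl, star_delta, hsd, hsr]
  have h1 : ∑ a, (c : ℂ) * (delta i o * compl o a j * (compl o a k * delta l o)) =
      c * (delta i o * delta l o * compl o j k) := by
    rw [← sum_compl_mul_compl o j k]
    simp only [Finset.mul_sum]
    refine Finset.sum_congr rfl fun a _ => ?_
    rw [compl_comm o j a]
    ring
  have h2 : ∑ a, (c : ℂ) * (compl o i a * delta j o * (delta k o * compl o l a)) =
      c * (compl o i l * (delta j o * delta k o)) := by
    rw [← sum_compl_mul_compl o i l]
    simp only [Finset.mul_sum, Finset.sum_mul]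
    refine Finset.sum_congr rfl fun a _ => ?_
    rw [compl_comm o l a]
    ring
  have h3 := sum_traceless_kernel hd o i j k l
  have h3' : ∑ a, ∑ b, ((1 : ℝ) : ℂ) * ((compl o i a * compl o b j -
      compl o a b * compl o i j / ((d : ℂ) - 1)) *
        (compl o b k * compl o l a - compl o l k * compl o a b / ((d : ℂ) - 1))) =
      compl o i l * compl o j k - compl o i j * compl o l k / ((d : ℂ) - 1) := by
    rw [← h3]
    refine Finset.sum_congr rfl fun a _ => Finset.sum_congr rfl fun b _ => ?_
    push_cast
    ring
  rw [h1, h2, h3']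
  ring

theorem sum_weight_mul_norm_act_sq {μ : Type*} [Fintype μ] (s : μ → ℝ) (K : μ → Op (Fin d))
    (v : EuclideanSpace ℂ (Fin d)) :
    ((∑ a, s a * ‖act (K a) v‖ ^ 2 : ℝ) : ℂ) =
      ∑ j, ∑ k, (∑ i, ∑ a, (s a : ℂ) * (K a i j * star (K a i k))) * (v j * star (v k)) := by
  have h : ∀ a, ((‖act (K a) v‖ ^ 2 : ℝ) : ℂ) =
      ∑ i, ∑ j, ∑ k, (K a i j * v j) * star (K a i k * v k) := fun a => by
    rw [norm_sq_eq_sum]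
    push_cast
    refine Finset.sum_congr rfl fun i _ => ?_
    rw [← Finset.sum_mul_sum, ← star_sum, ← act_apply, Complex.star_def, Complex.mul_conj,
      Complex.normSq_eq_norm_sq]
    push_cast
    rfl
  rw [Complex.ofReal_sum]
  simp only [Complex.ofReal_mul, h, Finset.mul_sum, Finset.sum_mul]
  rw [Finset.sum_comm]
  rw [Finset.sum_congr rfl fun i _ => Finset.sum_comm]
  rw [Finset.sum_comm]
  refine Finset.sum_congr rfl fun j _ => ?_
  rw [Finset.sum_congr rfl fun i _ => Finset.sum_comm]
  rw [Finset.sum_comm]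
  refine Finset.sum_congr rfl fun k _ => Finset.sum_congr rfl fun i _ =>
    Finset.sum_congr rfl fun a _ => ?_
  rw [star_mul]
  ring

/-- The last weight is 1 because this is the sum with absolute values. Cross terms between `o` and
its complement cancel since P annihilates `o`, so the quadratic form is diagonal. -/
theorem sum_kraus_norm_sq (hd : 2 ≤ d) (o : Fin d) (x y c β : ℝ) (v : EuclideanSpace ℂ (Fin d)) :
    ∑ a, krausWeight d c β 1 a * ‖act (kraus o x y a) v‖ ^ 2 =
      (c * ((d : ℝ) - 1) + x ^ 2) * ‖v o‖ ^ 2 +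
        (c + ((d : ℝ) - 1) - 1 / ((d : ℝ) - 1) + β + y ^ 2) * (‖v‖ ^ 2 - ‖v o‖ ^ 2) := by
  refine Complex.ofReal_injective ?_
  rw [sum_weight_mul_norm_act_sq]
  have hi : ∀ j k, ∑ i, ∑ a, (krausWeight d c β 1 a : ℂ) *
      (kraus o x y a i j * star (kraus o x y a i k)) =
      (c * ((d : ℂ) - 1) + x ^ 2) * (delta j o * delta k o) +
        (c + ((d : ℂ) - 1) - 1 / ((d : ℂ) - 1) + β + y ^ 2) *
          (delta j k - delta j o * delta k o) := fun j k => by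
    simp only [sum_kraus_kernel hd]
    have e : ∀ i : Fin d,
      (c : ℂ) * (delta i o * delta i o * compl o j k + compl o i i * (delta j o * delta k o)) +
        (compl o i i * compl o j k - compl o i j * compl o i k / ((d : ℂ) - 1)) +
        β * (compl o i j * compl o i k) +
        (1 : ℝ) * ((x * (delta i o * delta j o) + y * compl o i j) *
          (x * (delta i o * delta k o) + y * compl o i k)) =
      (c * compl o j k + x ^ 2 * (delta j o * delta k o)) * (delta i o * delta i o)
        + (c * (delta j o * delta k o) + compl o j k) * compl o i i
        + (β - 1 / ((d : ℂ) - 1) + y ^ 2) * (compl o j i * compl o i k)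
        + x * y * delta k o * (compl o j i * delta i o)
        + x * y * delta j o * (compl o k i * delta i o) := fun i => by
      rw [compl_comm o j i, compl_comm o k i]
      push_cast
      ring
    simp only [e, Finset.sum_add_distrib, ← Finset.mul_sum, sum_compl_mul_compl, sum_compl_self,
      sum_mul_delta, delta_self, compl_self_right]
    rw [← compl]
    ring
  simp only [hi]
  have n1 : ((‖v o‖ ^ 2 : ℝ) : ℂ) = v o * star (v o) := by
    rw [Complex.star_def, Complex.mul_conj, Complex.normSq_eq_norm_sq]
  have n2 : ((‖v‖ ^ 2 : ℝ) : ℂ) = ∑ j, v j * star (v j) := by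
    rw [norm_sq_eq_sum]
    push_cast
    refine Finset.sum_congr rfl fun j _ => ?_
    rw [Complex.star_def, Complex.mul_conj, Complex.normSq_eq_norm_sq]
    push_cast
    rfl
  push_cast at n1 n2 ⊢
  rw [n1, n2]
  have e2 : ∀ (A B : ℂ) (j : Fin d), ∑ k, (A * (delta j o * delta k o) +
      B * (delta j k - delta j o * delta k o)) * (v j * star (v k)) =
      (A - B) * (v j * star (v o)) * delta j o + B * (v j * star (v j)) := fun A B j => by
    have : ∀ k, (A * (delta j o * delta k o) +
      B * (delta j k - delta j o * delta k o)) * (v j * star (v k)) =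
      ((A - B) * v j * delta j o * star (v k)) * delta k o + B * v j * star (v k) * delta k j :=
      fun k => by
        rw [delta_comm k j]
        ring
    simp only [this, Finset.sum_add_distrib, sum_mul_delta]
    ring
  simp only [e2, Finset.sum_add_distrib, sum_mul_delta, ← Finset.mul_sum]
  ring

/-- On the span of |o⟩⟨o| and P, the `o`-diagonal coefficient fixes x² and the cross coefficient
fixes xy. The weight of P absorbs the remaining coefficient; the 1/(d-1) in it restores the trace
part removed from the traceless operators. -/
theorem difference_eq_sum_kraus (hd : 2 ≤ d) (n : ℕ) (o : Fin d) {x y : ℝ}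
    (hx : x ^ 2 = (n + 1) * ((d : ℝ) - 1)) (hxy : x * y = -((n + d - 1) * d / 2))
    (X : Op (Fin d)) :
    (measureAndReflect n (EuclideanSpace.single o 1) -
      reflectionChannel (EuclideanSpace.single o (1 : ℂ))) X =
      ∑ a, ((4 / ((n + d) * (n + d + 1)) * krausWeight d (n + 1)
        (y ^ 2 - (n + d) + 1 / ((d : ℝ) - 1)) (-1) a : ℝ) : ℂ) •
        (kraus o x y a * X * (kraus o x y a)ᴴ) := by
  ext i l
  rw [difference_apply (by omega), Matrix.sum_apply]
  have hm : ((d : ℂ) - 1) ≠ 0 := by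
    rw [sub_ne_zero]
    exact_mod_cast (by omega : d ≠ 1)
  have hx' : (x : ℂ) ^ 2 = (n + 1) * ((d : ℂ) - 1) := by exact_mod_cast congrArg Complex.ofReal hx
  have hxy' : (x : ℂ) * y = -((n + d - 1) * d / 2) := by exact_mod_cast congrArg Complex.ofReal hxy
  have key : ∀ j k, diffKernel n o i j k l = ∑ a, ((krausWeight d (n + 1)
        (y ^ 2 - (n + d) + 1 / ((d : ℝ) - 1)) (-1) a : ℝ) : ℂ) *
        (kraus o x y a i j * star (kraus o x y a l k)) := fun j k => by
    rw [sum_kraus_kernel hd, diffKernel]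
    push_cast
    simp only [compl]
    rw [delta_comm l k]
    field_simp
    linear_combination
      2 * (delta i o * delta j o * delta k o * delta l o * ((d : ℂ) - 1)) * hx' +
      2 * ((d : ℂ) - 1) * (delta i o * delta j o * (delta k l - delta k o * delta l o) +
        delta k o * delta l o * (delta i j - delta i o * delta j o)) * hxy'
  simp only [key, Matrix.smul_apply, smul_eq_mul, Matrix.mul_apply, Matrix.conjTranspose_apply,
    Finset.mul_sum, Finset.sum_mul]
  rw [Finset.sum_congr rfl fun j _ => Finset.sum_comm]
  rw [Finset.sum_comm]
  refine Finset.sum_congr rfl fun a _ => ?_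
  rw [Finset.sum_comm]
  refine Finset.sum_congr rfl fun j _ => Finset.sum_congr rfl fun k _ => ?_
  push_cast
  ring

theorem traceNorm_tensorId_difference_le (hd : 2 ≤ d) (n : ℕ) (o : Fin d) {x y C : ℝ}
    (hx : x ^ 2 = (n + 1) * ((d : ℝ) - 1)) (hxy : x * y = -((n + d - 1) * d / 2))
    (hβ : (n : ℝ) + d - 1 / ((d : ℝ) - 1) ≤ y ^ 2) (hxC : x ^ 2 ≤ C) (hyC : y ^ 2 ≤ C)
    (X : Op (Fin d × Fin d)) :
    traceNorm (tensorId (Fin d) (measureAndReflect n (EuclideanSpace.single o 1) -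
      reflectionChannel (EuclideanSpace.single o (1 : ℂ))) X) ≤
      (8 * C / ((n + d + 1) * (n + d))) * traceNorm X := by
  have hC : 0 ≤ C := (sq_nonneg x).trans hxC
  have hd2 : (2 : ℝ) ≤ d := by exact_mod_cast hd
  have hn : (0 : ℝ) ≤ n := n.cast_nonneg
  refine traceNorm_tensorId_le _ _ _ (difference_eq_sum_kraus hd n o hx hxy) (by positivity)
    (fun v => ?_) X
  -- Only the last weight changes, from -1 to 1; `hβ` says that the weight of P is nonnegative.
  have hw : ∀ a, |4 / (((n : ℝ) + d) * (n + d + 1)) * krausWeight d (n + 1)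
        (y ^ 2 - (n + d) + 1 / ((d : ℝ) - 1)) (-1) a| = 4 / (((n : ℝ) + d) * (n + d + 1)) *
        krausWeight d (n + 1) (y ^ 2 - (n + d) + 1 / ((d : ℝ) - 1)) 1 a := fun a => by
    rw [abs_mul, abs_of_nonneg (by positivity : (0 : ℝ) ≤ 4 / (((n : ℝ) + d) * (n + d + 1)))]
    congr 1
    rcases a with a | a | _ | _
    · exact abs_of_nonneg (by simp only [krausWeight]; positivity)
    · exact abs_one
    · simp [krausWeight]
    · exact abs_of_nonneg (by simp only [krausWeight]; linarith)
  simp only [hw, mul_assoc]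
  rw [← Finset.mul_sum, sum_kraus_norm_sq hd]
  have hvo : ‖v o‖ ^ 2 ≤ ‖v‖ ^ 2 := by
    rw [norm_sq_eq_sum]
    exact Finset.single_le_sum (f := fun i => ‖v i‖ ^ 2) (fun _ _ => by positivity)
      (Finset.mem_univ o)
  -- With these weights the two eigenvalues of the form are exactly 2x² and 2y².
  have h1 : (((n : ℝ) + 1) * ((d : ℝ) - 1) + x ^ 2) * ‖v o‖ ^ 2 ≤ 2 * C * ‖v o‖ ^ 2 :=
    mul_le_mul_of_nonneg_right (by linarith) (by positivity)
  have h2 : ((n : ℝ) + 1 + ((d : ℝ) - 1) - 1 / ((d : ℝ) - 1) + (y ^ 2 - (n + d) +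
      1 / ((d : ℝ) - 1)) + y ^ 2) * (‖v‖ ^ 2 - ‖v o‖ ^ 2) ≤ 2 * C * (‖v‖ ^ 2 - ‖v o‖ ^ 2) :=
    mul_le_mul_of_nonneg_right (by linarith) (by linarith)
  calc 4 / (((n : ℝ) + d) * (n + d + 1)) * _
      ≤ 4 / (((n : ℝ) + d) * (n + d + 1)) * (2 * C * ‖v‖ ^ 2) :=
        mul_le_mul_of_nonneg_left (by linarith) (by positivity)
    _ = _ := by
      field_simp
      ring

end OperatorSum

/-! ### Matching upper and lower bounds -/

section Bounds

variable {d : ℕ}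

/-- The diamond distance in the regime where a product input is optimal. -/
def mrRate (d n : ℕ) : ℝ :=
  8 * ((n : ℝ) + 1) * ((d : ℝ) - 1) / (((n : ℝ) + d + 1) * ((n : ℝ) + d))

theorem mrRate_pos (hd : 2 ≤ d) (n : ℕ) : 0 < mrRate d n := by
  have hd2 : (2 : ℝ) ≤ d := by exact_mod_cast hd
  have : 0 < (d : ℝ) - 1 := by linarith
  unfold mrRate
  positivity

theorem exists_kraus_coefficients (hd : 2 ≤ d) (n : ℕ) : ∃ x y : ℝ,
    x ^ 2 = (n + 1) * ((d : ℝ) - 1) ∧ x * y = -((n + d - 1) * d / 2) ∧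
      (n : ℝ) + d - 1 / ((d : ℝ) - 1) ≤ y ^ 2 ∧
      ((d = 2 ∨ d ≤ n + 1) → y ^ 2 ≤ x ^ 2) := by
  have hd2 : (2 : ℝ) ≤ d := by exact_mod_cast hd
  have hn : (0 : ℝ) ≤ n := n.cast_nonneg
  have hm : 0 < (d : ℝ) - 1 := by linarith
  have hx : 0 < ((n : ℝ) + 1) * ((d : ℝ) - 1) := by positivity
  have hx0 : √(((n : ℝ) + 1) * ((d : ℝ) - 1)) ≠ 0 := (Real.sqrt_pos.2 hx).ne'
  have hsq := Real.sq_sqrt hx.le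
  have hy : (-(((n : ℝ) + d - 1) * d / 2) / √(((n : ℝ) + 1) * ((d : ℝ) - 1))) ^ 2 =
      (((n : ℝ) + d - 1) * d / 2) ^ 2 / (((n : ℝ) + 1) * ((d : ℝ) - 1)) := by
    rw [div_pow, hsq, neg_sq]
  refine ⟨√(((n : ℝ) + 1) * ((d : ℝ) - 1)),
    -(((n : ℝ) + d - 1) * d / 2) / √(((n : ℝ) + 1) * ((d : ℝ) - 1)), hsq,
    mul_div_cancel₀ _ hx0, ?_, fun h => ?_⟩
  · rw [hy, ← sub_nonneg]
    -- The weight of P is a perfect square over a positive denominator, hence nonnegative for all n.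
    have : (((n : ℝ) + d - 1) * d / 2) ^ 2 / (((n : ℝ) + 1) * ((d : ℝ) - 1)) -
        ((n : ℝ) + d - 1 / ((d : ℝ) - 1)) =
        (((d : ℝ) - 2) * (n + 1 + d)) ^ 2 / (4 * (((n : ℝ) + 1) * ((d : ℝ) - 1))) := by
      field_simp
      ring
    rw [this]
    positivity
  · rw [hy, hsq, div_le_iff₀ hx, ← sq]
    refine pow_le_pow_left₀ (by have : 0 ≤ (n : ℝ) + d - 1 := by linarith
                                positivity) ?_ 2
    rcases h with h | h
    · subst h
      push_cast
      linarith
    · have h' : (d : ℝ) ≤ n + 1 := by exact_mod_cast h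
      -- (n+1)(d-1) - (n+d-1)d/2 = (d-2)(n+1-d)/2.
      nlinarith [mul_nonneg (sub_nonneg.2 hd2) (sub_nonneg.2 h')]

theorem mrDistance_single_le (hd : 2 ≤ d) (n : ℕ) (o : Fin d) (h : d = 2 ∨ d ≤ n + 1) :
    mrDistance n (EuclideanSpace.single o (1 : ℂ)) ≤ mrRate d n := by
  obtain ⟨x, y, hx, hxy, hβ, hyx⟩ := exists_kraus_coefficients hd n
  have := traceNorm_tensorId_difference_le hd n o hx hxy hβ le_rfl (hyx h)
  refine (diamondNorm_le _ ?_ this).trans (le_of_eq ?_)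
  · positivity
  · rw [hx, mrRate]
    ring

theorem diffKernel_diag (n : ℕ) (o i : Fin d) :
    diffKernel n o i o o i = (n + 1) * (1 - d * delta i o) := by
  have h : delta i o * delta i o = delta i o := by
    simp [delta]
  have h' : delta i i = 1 := delta_self i
  rw [diffKernel, h', delta_self, delta_comm o i]
  linear_combination (n * (n - 1) - (n + d) * (n + d + 1) + (n + d + 1) * d + 2 * n + n
    - (n + d) : ℂ) * h

/-- On the input |oo⟩⟨oo| the output has diagonal proportional to 1-d at (o,o) and 1 at the other
(i,o). A diagonal sign matrix, negative on i = o, turns the trace into the sum of absolute values,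
which is proportional to 2(d-1). -/
theorem le_mrDistance_single (hd : 2 ≤ d) (n : ℕ) (o : Fin d) :
    mrRate d n ≤ mrDistance n (EuclideanSpace.single o (1 : ℂ)) := by
  have hd2 : (2 : ℝ) ≤ d := by exact_mod_cast hd
  have hn : (0 : ℝ) ≤ n := n.cast_nonneg
  obtain ⟨x, y, hx, hxy, hβ, -⟩ := exists_kraus_coefficients hd n
  -- For small n possibly y² > x²; any finite bound suffices here, so the maximum is used.
  have hbd := traceNorm_tensorId_difference_le hd n o hx hxy hβ (le_max_left _ (y ^ 2))
    (le_max_right (x ^ 2) _)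
  set e : EuclideanSpace ℂ (Fin d × Fin d) := EuclideanSpace.single (o, o) 1 with he
  have hX : traceNorm (rankOne e e) ≤ 1 := by
    have := traceNorm_sum_rankOne_le (Finset.univ : Finset Unit) (fun _ => e) (fun _ => e)
    simpa [he] using this
  have hC : 0 ≤ 8 * max (x ^ 2) (y ^ 2) / (((n : ℝ) + d + 1) * (n + d)) := by
    have : 0 ≤ max (x ^ 2) (y ^ 2) := (sq_nonneg x).trans (le_max_left _ _)
    positivity
  refine le_trans ?_ (le_diamondNorm _ hC hbd (rankOne e e) hX)
  set Ψ := measureAndReflect n (EuclideanSpace.single o 1) -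
      reflectionChannel (EuclideanSpace.single o (1 : ℂ)) with hΨ
  let f : Fin d × Fin d → ℂ := fun p => 1 - 2 * delta p.1 o
  have hf : ∀ p, ‖f p‖ = 1 := fun p => by
    simp only [f, delta]
    split_ifs <;> norm_num
  have hU : ∀ v, ‖act (Matrix.diagonal f) v‖ ≤ ‖v‖ := fun v => by
    refine le_of_eq ?_
    rw [EuclideanSpace.norm_eq, EuclideanSpace.norm_eq]
    congr 1
    refine Finset.sum_congr rfl fun p _ => ?_
    have h : act (Matrix.diagonal f) v p = f p * v p := Matrix.mulVec_diagonal f v.ofLp p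
    rw [h, norm_mul, hf, one_mul]
  refine le_trans (le_of_eq ?_) (norm_trace_mul_le_traceNorm (Matrix.diagonal f) _ hU)
  have hentry : ∀ i b, tensorId (Fin d) Ψ (rankOne e e) (i, b) (i, b) =
      4 / ((n + d) * (n + d + 1)) * diffKernel n o i o o i * delta b o := fun i b => by
    have hblock : ∀ j k, rankOne e e (j, b) (k, b) = delta j o * delta k o * delta b o :=
      fun j k => by
        simp only [rankOne_apply, he, PiLp.single_apply, delta, Prod.mk.injEq]
        by_cases h1 : j = o <;> by_cases h2 : k = o <;> by_cases h3 : b = o <;> simp [h1, h2, h3]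
    simp only [tensorId, LinearMap.coe_mk, AddHom.coe_mk, Matrix.of_apply]
    rw [hΨ, difference_apply (by omega)]
    simp only [Matrix.of_apply, hblock]
    have : ∀ j k, 4 / (((n : ℂ) + d) * (n + d + 1)) * diffKernel n o i j k i *
        (delta j o * delta k o * delta b o) = (4 / (((n : ℂ) + d) * (n + d + 1)) *
          diffKernel n o i j k i * delta j o * delta b o) * delta k o := fun j k => by ring
    simp only [this, sum_mul_delta]
    rw [← sum_mul_delta (fun j => 4 / (((n : ℂ) + d) * (n + d + 1)) *
          diffKernel n o i j o i * delta b o) o]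
    exact Finset.sum_congr rfl fun j _ => by ring
  have htr : (Matrix.diagonal f * tensorId (Fin d) Ψ (rankOne e e)).trace =
      ((mrRate d n : ℝ) : ℂ) := by
    simp only [Matrix.trace, Matrix.diag_apply, Matrix.diagonal_mul, Fintype.sum_prod_type, hentry,
      diffKernel_diag]
    have e1 : ∀ i b : Fin d, f (i, b) * (4 / ((n + d) * (n + d + 1)) *
        ((n + 1) * (1 - d * delta i o)) * delta b o) =
        (4 / ((n + d) * (n + d + 1)) * (n + 1) * (1 - d * delta i o) * (1 - 2 * delta i o)) *
          delta b o := fun i b => by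
      simp only [f]
      ring
    simp only [e1, sum_mul_delta]
    have e2 : ∀ i : Fin d, 4 / (((n : ℂ) + d) * (n + d + 1)) * (n + 1) * (1 - d * delta i o) *
        (1 - 2 * delta i o) = 4 / (((n : ℂ) + d) * (n + d + 1)) * (n + 1) * delta i i +
        (4 / (((n : ℂ) + d) * (n + d + 1)) * (n + 1) * (d - 2)) * delta i o := fun i => by
      have h : delta i o * delta i o = delta i o := by simp [delta]
      rw [delta_self i]
      linear_combination 4 / (((n : ℂ) + d) * (n + d + 1)) * (n + 1) * (2 * d) * h
    simp only [e2, Finset.sum_add_distrib, sum_mul_delta]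
    rw [← Finset.mul_sum, sum_delta_self, mrRate]
    push_cast
    rw [mul_comm ((n : ℂ) + d) (n + d + 1)]
    ring
  rw [htr, Complex.norm_real, Real.norm_of_nonneg (mrRate_pos hd n).le]

variable {ψ : EuclideanSpace ℂ (Fin d)}

theorem mrRate_le_mrDistance (hd : 2 ≤ d) (hψ : ‖ψ‖ = 1) (n : ℕ) :
    mrRate d n ≤ mrDistance n ψ := by
  rw [mrDistance_eq_single (by omega) ⟨0, by omega⟩ hψ]
  exact le_mrDistance_single hd n _

/-- The diamond distance is exactly `mrRate d n` for qubits, and once `n ≥ d - 1`. -/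
theorem mrDistance_eq_mrRate (hd : 2 ≤ d) (hψ : ‖ψ‖ = 1) {n : ℕ} (h : d = 2 ∨ d ≤ n + 1) :
    mrDistance n ψ = mrRate d n := by
  refine le_antisymm ?_ (mrRate_le_mrDistance hd hψ n)
  rw [mrDistance_eq_single (by omega) ⟨0, by omega⟩ hψ]
  exact mrDistance_single_le hd n _ h

end Bounds

/-! ### Asymptotics of the rate and inversion to the copy count -/

section Asymptotics

theorem tendsto_nat_mul_mrRate (d : ℕ) :
    Tendsto (fun n : ℕ => (n : ℝ) * mrRate d n) atTop (𝓝 (8 * ((d : ℝ) - 1))) := by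
  have h1 : ∀ c : ℝ, Tendsto (fun n : ℕ => c / (n : ℝ)) atTop (𝓝 0) := fun c =>
    tendsto_const_div_atTop_nhds_zero_nat c
  have h2 : Tendsto (fun n : ℕ => 8 * (1 + 1 / (n : ℝ)) * ((d : ℝ) - 1) /
      ((1 + ((d : ℝ) + 1) / n) * (1 + (d : ℝ) / n))) atTop
      (𝓝 (8 * (1 + 0) * ((d : ℝ) - 1) / ((1 + 0) * (1 + 0)))) := by
    refine Tendsto.div ?_ ?_ (by norm_num)
    · exact (((h1 1).const_add 1).const_mul 8).mul_const _
    · exact ((h1 _).const_add 1).mul ((h1 _).const_add 1)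
  simp only [add_zero, mul_one, div_one] at h2
  refine h2.congr' ?_
  filter_upwards [eventually_gt_atTop 0] with n hn
  have hn' : (0 : ℝ) < n := by exact_mod_cast hn
  rw [mrRate]
  have : (0 : ℝ) ≤ d := d.cast_nonneg
  field_simp
  ring

theorem isEquivalent_const_div {D : ℕ → ℝ} {c : ℝ} (hc : c ≠ 0)
    (h : Tendsto (fun n : ℕ => (n : ℝ) * D n) atTop (𝓝 c)) :
    D ~[atTop] fun n : ℕ => c / (n : ℝ) := by
  refine isEquivalent_of_tendsto_one ?_
  have h1 := h.div_const c
  rw [div_self hc] at h1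
  refine h1.congr' (Eventually.of_forall fun n => ?_)
  simp only [Pi.div_apply, div_div_eq_mul_div]
  rw [mul_comm]

/-- Inverting a sequence that decays like `c / n`: the first index at which it drops to `ε` grows
like `c / ε`. -/
theorem exists_le_and_sInf_isEquivalent {D : ℕ → ℝ} {c : ℝ} (hc : c ≠ 0) (hD : ∀ n, 0 < D n)
    (h : Tendsto (fun n : ℕ => (n : ℝ) * D n) atTop (𝓝 c)) :
    (∀ ε : ℝ, 0 < ε → ∃ n, D n ≤ ε) ∧
      (fun ε : ℝ => ((sInf {n | D n ≤ ε} : ℕ) : ℝ)) ~[𝓝[>] 0] fun ε : ℝ => c / ε := by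
  have hD0 : Tendsto D atTop (𝓝 0) := by
    have h1 := h.mul (tendsto_inv_atTop_nhds_zero_nat (𝕜 := ℝ))
    rw [mul_zero] at h1
    refine h1.congr' ?_
    filter_upwards [eventually_gt_atTop 0] with n hn
    have hn' : (n : ℝ) ≠ 0 := by exact_mod_cast hn.ne'
    field_simp
  have hex : ∀ ε : ℝ, 0 < ε → ∃ n, D n ≤ ε := fun ε hε =>
    ((hD0.eventually (gt_mem_nhds hε)).mono fun _ hn => le_of_lt hn).exists
  refine ⟨hex, ?_⟩
  let N : ℝ → ℕ := fun ε => sInf {n | D n ≤ ε}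
  have hN : ∀ ε : ℝ, 0 < ε → D (N ε) ≤ ε := fun ε hε => Nat.sInf_mem (hex ε hε)
  have hNlt : ∀ ε : ℝ, ∀ n < N ε, ε < D n := fun ε n hn =>
    not_le.1 fun hle => Nat.notMem_of_lt_sInf hn hle
  have hpos : ∀ᶠ ε : ℝ in 𝓝[>] 0, 0 < ε := self_mem_nhdsWithin
  -- Each D n is positive, so once ε is below the first M values the threshold index is at least M.
  have hNtop : Tendsto N (𝓝[>] 0) atTop := by
    refine tendsto_atTop.2 fun M => ?_
    have hM : ∀ᶠ ε : ℝ in 𝓝[>] 0, ∀ n ∈ Finset.range M, ε < D n :=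
      (Filter.eventually_all_finset _).2 fun n _ =>
        (eventually_lt_nhds (hD n)).filter_mono nhdsWithin_le_nhds
    filter_upwards [hM, hpos] with ε hε hε0
    by_contra hlt
    exact absurd (hN ε hε0) (not_le.2 (hε _ (Finset.mem_range.2 (not_le.1 hlt))))
  have hlow : Tendsto (fun ε => (N ε : ℝ) * D (N ε)) (𝓝[>] 0) (𝓝 c) := h.comp hNtop
  have hup : Tendsto (fun n : ℕ => ((n : ℝ) + 1) * D n) atTop (𝓝 c) := by
    have := h.add hD0
    rw [add_zero] at this
    exact this.congr fun n => by ring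
  have hup' : Tendsto (fun ε => (((N ε - 1 : ℕ) : ℝ) + 1) * D (N ε - 1)) (𝓝[>] 0) (𝓝 c) :=
    hup.comp ((tendsto_sub_atTop_nat 1).comp hNtop)
  -- Squeeze from D (N ε) ≤ ε < D (N ε - 1); the truncated subtraction is harmless once N ε ≥ 1.
  have hmid : Tendsto (fun ε => (N ε : ℝ) * ε) (𝓝[>] 0) (𝓝 c) := by
    refine tendsto_of_tendsto_of_tendsto_of_le_of_le' hlow hup' ?_ ?_
    · filter_upwards [hpos] with ε hε
      exact mul_le_mul_of_nonneg_left (hN ε hε) (Nat.cast_nonneg _)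
    · filter_upwards [hNtop.eventually_ge_atTop 1] with ε hε
      have e : (((N ε - 1 : ℕ) : ℝ) + 1) = N ε := by
        rw [Nat.cast_sub hε]
        push_cast
        ring
      rw [e]
      exact mul_le_mul_of_nonneg_left (hNlt ε _ (by omega)).le (Nat.cast_nonneg _)
  refine isEquivalent_of_tendsto_one ?_
  have h1 := hmid.div_const c
  rw [div_self hc] at h1
  refine h1.congr' (Eventually.of_forall fun ε => ?_)
  simp only [Pi.div_apply, div_div_eq_mul_div]
  rfl

end Asymptotics

end MeasureReflect

end

theorem mainTheorem9 (d : ℕ) (hd : 2 ≤ d) (ψ : EuclideanSpace ℂ (Fin d)) (hψ : ‖ψ‖ = 1) :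
    (∀ n : ℕ, 8 * ((n : ℝ) + 1) * ((d : ℝ) - 1) / (((n : ℝ) + d + 1) * ((n : ℝ) + d)) ≤
        MeasureReflect.mrDistance n ψ) ∧
    (d = 2 → ∀ n : ℕ, MeasureReflect.mrDistance n ψ =
        8 * ((n : ℝ) + 1) * ((d : ℝ) - 1) / (((n : ℝ) + d + 1) * ((n : ℝ) + d))) ∧
    ((fun n : ℕ => MeasureReflect.mrDistance n ψ) ~[atTop]
        fun n : ℕ => 4 * ((d : ℝ) + √((d : ℝ) * ((d : ℝ) - 2) + 1) - 1) / (n : ℝ)) ∧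
    ((∀ ε : ℝ, 0 < ε → ∃ n : ℕ, MeasureReflect.mrDistance n ψ ≤ ε) ∧
      (fun ε : ℝ => (MeasureReflect.copyCount ψ ε : ℝ)) ~[𝓝[>] 0]
        fun ε : ℝ => 4 * ((d : ℝ) + √((d : ℝ) * ((d : ℝ) - 2) + 1) - 1) / ε) := by
  have hd2 : (2 : ℝ) ≤ d := by exact_mod_cast hd
  -- The radicand is (d-1)², so the constant is 8(d-1).
  have hconst : 4 * ((d : ℝ) + √((d : ℝ) * ((d : ℝ) - 2) + 1) - 1) = 8 * ((d : ℝ) - 1) := by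
    rw [show (d : ℝ) * ((d : ℝ) - 2) + 1 = ((d : ℝ) - 1) ^ 2 by ring,
      Real.sqrt_sq (by linarith)]
    ring
  have hc : 8 * ((d : ℝ) - 1) ≠ 0 := by
    have : 0 < (d : ℝ) - 1 := by linarith
    positivity
  have hlim : Tendsto (fun n : ℕ => (n : ℝ) * MeasureReflect.mrDistance n ψ) atTop
      (𝓝 (8 * ((d : ℝ) - 1))) := by
    refine (MeasureReflect.tendsto_nat_mul_mrRate d).congr' ?_
    filter_upwards [eventually_ge_atTop d] with n hn
    rw [MeasureReflect.mrDistance_eq_mrRate hd hψ (Or.inr (by omega))]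
  rw [hconst]
  exact ⟨MeasureReflect.mrRate_le_mrDistance hd hψ,
    fun h n => MeasureReflect.mrDistance_eq_mrRate hd hψ (Or.inl h),
    MeasureReflect.isEquivalent_const_div hc hlim,
    MeasureReflect.exists_le_and_sInf_isEquivalent hc
      (fun n => (MeasureReflect.mrRate_pos hd n).trans_le
        (MeasureReflect.mrRate_le_mrDistance hd hψ n)) hlim⟩
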